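/- Let $\mathbb{F}$ be a field and let $D,n,r\ge 1$ be integers. A (non-commutative) algebraic branching program (ABP) of depth $D$ is a finite directed graph whose vertices are partitioned into levels $0,\dots,D$, with edges only from a level $i-1$ to level $i$, with exactly one vertex of in-degree zero (the source, the only vertex of level $0$) and exactly one vertex of out-degree zero (the sink, the only vertex of level $D$), each edge being labelled by an affine function $c+\sum_i a_i x_i$ ($c,a_i\in\mathbb{F}$) of the non-commuting variables $x_0,\dots,x_{n-1}$. It computes the polynomial in $\mathbb{F}\{x_0,\dots,x_{n-1}\}$ that is the sum, over all directed source-sink paths, of the product of the labels in the order of the path. Its width is the maximal number of vertices in a level. Let $\mathcal{NC}$ be the set of $n$-variate non-commutative polynomials computed by ABPs of width at most $r$ and depth $D$. If $|\mathbb{F}|\ge (2(D+1)^5nr^4)^2$, then $\mathcal{NC}$ has a $\mathrm{poly}(D,n,r)$-explicit hitting set over $(D+1)\times(D+1)$ matrices of size at most $(2(D+1)^4n^2r^3)^{\lceil \log_2 D\rceil+1}$. That is, there is a set $\mathcal{H}\subseteq(\mathbb{F}^{(D+1)\times(D+1)})^n$ such that every $f\in\mathcal{NC}$ satisfies: $f=0$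 if and only if $f(X_0,\dots,X_{n-1})=0$ for all $(X_0,\dots,X_{n-1})\in\mathcal{H}$; and $\mathcal{H}$ is listed, possibly with repetitions, by an index $k\in\{0,\dots,M-1\}$, where $M\le(2(D+1)^4n^2r^3)^{\lceil \log_2 D\rceil+1}$, in such a way that the $k$-th element is computed from $(D,n,r,k)$ in time $\mathrm{poly}(D,n,r)$. Here one program and one polynomial time bound serve for all $\mathbb{F},D,n,r$ (subject to the bound on $|\mathbb{F}|$) and all $k<M$. The machine is a random access machine with arrays of natural numbers, whose operations are charged by the bit length of their operands, and arrays of elements of $\mathbb{F}$, on which field operations and equality tests have unit cost; it has access to an arbitrary fixed repetition-free listing $e_0,e_1,\dots$ of elements of $\mathbb{F}$ (all of them if $\mathbb{F}$ is finite, infinitely many otherwise), where obtaining $e_i$ costs $i+1$. -/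

import Mathlib

/-! ### Non-commutative algebraic branching programs -/

/-- An algebraic branching program of depth `D` over the non-commuting variables `x_0, …, x_{n-1}`:
a finite directed graph (vertices numbered by `Fin size`, where `size` is the size of the program),
with vertices partitioned into levels `0, …, D`, edges only from a level to the next one,
exactly one vertex of in-degree zero (the source, the only vertex at level `0`), exactly one
vertex of out-degree zero (the sink, the only vertex at level `D`), and each edge labelled by
an affine function of the variables. -/
structure NCBranchingProgram (F : Type*) [Field F] (n D : ℕ) where
  size : ℕ
  level : Fin size → Fin (D + 1)
  Edge : Fin size → Fin size → Prop
  label : Fin size → Fin size → FreeAlgebra F (Fin n)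
  source : Fin size
  sink : Fin size
  edge_level : ∀ u v, Edge u v → (level v : ℕ) = (level u : ℕ) + 1
  in_degree_zero_iff : ∀ v, (∀ u, ¬ Edge u v) ↔ v = source
  out_degree_zero_iff : ∀ u, (∀ v, ¬ Edge u v) ↔ u = sink
  level_eq_zero_iff : ∀ v, level v = 0 ↔ v = source
  level_eq_last_iff : ∀ v, level v = Fin.last D ↔ v = sink
  label_affine : ∀ u v, Edge u v → ∃ (c : F) (a : Fin n → F),
    label u v = algebraMap F (FreeAlgebra F (Fin n)) c + ∑ i, a i • FreeAlgebra.ι F i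

namespace NCBranchingProgram

variable {F : Type*} [Field F] {n D : ℕ}

/-- The maximal number of vertices in a level. -/
def width (A : NCBranchingProgram F n D) : ℕ :=
  Finset.univ.sup fun i : Fin (D + 1) =>
    (Finset.univ.filter fun v : Fin A.size => A.level v = i).card

/-- `p` lists the vertices of a directed path from the source to the sink. Since edges go from
each level to the next one, every such path has exactly `D + 1` vertices. -/
def IsPath (A : NCBranchingProgram F n D) (p : Fin (D + 1) → Fin A.size) : Prop :=
  p 0 = A.source ∧ p (Fin.last D) = A.sink ∧ ∀ i : Fin D, A.Edge (p i.castSucc) (p i.succ)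

open Classical in
/-- The polynomial computed by the program: the sum, over all directed source-sink paths, of the
product of the labels in the order of the path. -/
noncomputable def poly (A : NCBranchingProgram F n D) : FreeAlgebra F (Fin n) :=
  ∑ p ∈ Finset.univ.filter A.IsPath,
    (List.ofFn fun i : Fin D => A.label (p i.castSucc) (p i.succ)).prod

end NCBranchingProgram

/-- The `n`-variate non-commutative polynomials computable by branching programs of
width (at most) `r` and depth `D`. -/
def NCABPClass (F : Type*) [Field F] (n r D : ℕ) : Set (FreeAlgebra F (Fin n)) :=
  {f | ∃ A : NCBranchingProgram F n D, A.width ≤ r ∧ A.poly = f}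

/-- `H` is a hitting set, over the `F`-algebra `R`, for the class `C` of non-commutative
polynomials. -/
def IsHittingSet {F R : Type*} [Field F] [Ring R] [Algebra F R] {n : ℕ}
    (C : Set (FreeAlgebra F (Fin n))) (H : Set (Fin n → R)) : Prop :=
  ∀ f ∈ C, (f = 0 ↔ ∀ x ∈ H, FreeAlgebra.lift F x f = 0)

/-! ### Random access machines over a field

Programs work on finitely many named arrays of natural numbers and finitely many named arrays of
field elements. Natural number operations are charged by the bit lengths of their operands,
field operations and field equality tests are charged one unit. A program mentions no particular
field; it reaches the elements of the field through the constants `0` and `1`, the field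
operations, and a listing `enum : ℕ → F` of field elements, whose `i`-th entry costs `i + 1`. -/

/-- Expressions for natural numbers; `get a i` is the entry at index `i` of the array named `a`. -/
inductive NatExpr : Type
  | const (c : ℕ)
  | get (a : ℕ) (i : NatExpr)
  | add (x y : NatExpr)
  | sub (x y : NatExpr)
  | mul (x y : NatExpr)
  | div (x y : NatExpr)
  | mod (x y : NatExpr)

/-- Expressions for field elements; `get a i` is the entry at index `i` of the field array
named `a`, and `enum i` is the `i`-th element of the listing of the field. -/
inductive FieldExpr : Type
  | zero
  | one
  | get (a : ℕ) (i : NatExpr)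
  | enum (i : NatExpr)
  | add (x y : FieldExpr)
  | sub (x y : FieldExpr)
  | mul (x y : FieldExpr)
  | inv (x : FieldExpr)

/-- Programs. `setNat a i x` and `setField a i x` assign `x` to the entry at index `i` of the
array named `a`; `ifLe` branches on `x ≤ y`, `ifEq` on equality of two field elements;
`loop a b c` evaluates `b` once and executes `c` that many times, the entry at index `0` of the
array `a` being set to the number of the round (counted from `0`) before each round. -/
inductive Prog : Type
  | skip
  | setNat (a : ℕ) (i x : NatExpr)
  | setField (a : ℕ) (i : NatExpr) (x : FieldExpr)
  | seq (c d : Prog)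
  | ifLe (x y : NatExpr) (c d : Prog)
  | ifEq (x y : FieldExpr) (c d : Prog)
  | loop (a : ℕ) (b : NatExpr) (c : Prog)

/-- The memory: `nat a i` and `fld a i` are the entries at index `i` of the arrays named `a`. -/
structure Memory (F : Type*) where
  nat : ℕ → ℕ → ℕ
  fld : ℕ → ℕ → F

namespace Memory

variable {F : Type*}

def setNat (s : Memory F) (a i v : ℕ) : Memory F :=
  { s with nat := Function.update s.nat a (Function.update (s.nat a) i v) }

def setFld (s : Memory F) (a i : ℕ) (v : F) : Memory F :=
  { s with fld := Function.update s.fld a (Function.update (s.fld a) i v) }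

end Memory

namespace NatExpr

variable {F : Type*}

def eval (s : Memory F) : NatExpr → ℕ
  | const c => c
  | get a i => s.nat a (i.eval s)
  | add x y => x.eval s + y.eval s
  | sub x y => x.eval s - y.eval s
  | mul x y => x.eval s * y.eval s
  | div x y => x.eval s / y.eval s
  | mod x y => x.eval s % y.eval s

/-- The cost of evaluating an expression (`Nat.size` is the bit length). -/
def cost (s : Memory F) : NatExpr → ℕ
  | const c => 1 + c.size
  | get a i => i.cost s + 1 + (i.eval s).size + (s.nat a (i.eval s)).size
  | add x y => x.cost s + y.cost s + 1 + (x.eval s).size + (y.eval s).size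
  | sub x y => x.cost s + y.cost s + 1 + (x.eval s).size + (y.eval s).size
  | mul x y => x.cost s + y.cost s + 1 + (x.eval s).size + (y.eval s).size
  | div x y => x.cost s + y.cost s + 1 + (x.eval s).size + (y.eval s).size
  | mod x y => x.cost s + y.cost s + 1 + (x.eval s).size + (y.eval s).size

end NatExpr

namespace FieldExpr

variable {F : Type*} [Field F]

def eval (e : ℕ → F) (s : Memory F) : FieldExpr → F
  | zero => 0
  | one => 1
  | get a i => s.fld a (i.eval s)
  | enum i => e (i.eval s)
  | add x y => x.eval e s + y.eval e s
  | sub x y => x.eval e s - y.eval e s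
  | mul x y => x.eval e s * y.eval e s
  | inv x => (x.eval e s)⁻¹

/-- The cost of evaluating an expression. -/
def cost (s : Memory F) : FieldExpr → ℕ
  | zero => 1
  | one => 1
  | get _ i => i.cost s + 1 + (i.eval s).size
  | enum i => i.cost s + 1 + i.eval s
  | add x y => x.cost s + y.cost s + 1
  | sub x y => x.cost s + y.cost s + 1
  | mul x y => x.cost s + y.cost s + 1
  | inv x => x.cost s + 1

end FieldExpr

namespace Prog

variable {F : Type*} [Field F]

open Classical in
/-- Execution of a program: the final memory and the running time. -/
noncomputable def exec (e : ℕ → F) : Prog → Memory F → Memory F × ℕ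
  | skip, s => (s, 1)
  | setNat a i x, s =>
      (s.setNat a (i.eval s) (x.eval s),
        i.cost s + x.cost s + 1 + (i.eval s).size + (x.eval s).size)
  | setField a i x, s =>
      (s.setFld a (i.eval s) (x.eval e s), i.cost s + x.cost s + 1 + (i.eval s).size)
  | seq c d, s =>
      ((exec e d (exec e c s).1).1, (exec e c s).2 + (exec e d (exec e c s).1).2)
  | ifLe x y c d, s =>
      let t := if x.eval s ≤ y.eval s then exec e c s else exec e d s
      (t.1, x.cost s + y.cost s + 1 + (x.eval s).size + (y.eval s).size + t.2)
  | ifEq x y c d, s =>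
      let t := if x.eval e s = y.eval e s then exec e c s else exec e d s
      (t.1, x.cost s + y.cost s + 1 + t.2)
  | loop a b c, s =>
      Nat.rec (motive := fun _ => Memory F × ℕ) (s, b.cost s + 1 + (b.eval s).size)
        (fun j p => ((exec e c (p.1.setNat a 0 j)).1,
          p.2 + 1 + j.size + (exec e c (p.1.setNat a 0 j)).2))
        (b.eval s)

/-- The initial memory: the numbers `D, n, r, k` are stored in this order as the first four
entries of the array of natural numbers named `0`; everything else is zero. -/
def input (F : Type*) [Field F] (D n r k : ℕ) : Memory F where
  nat a i := if a = 0 then ([D, n, r, k].getD i 0) else 0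
  fld _ _ := 0

/-- The output on input `(D, n, r, k)`: an `n`-tuple of `(D+1) × (D+1)` matrices, read off from
the field array named `0`, matrix after matrix and each matrix row after row. -/
noncomputable def output (P : Prog) (e : ℕ → F) (D n r k : ℕ) :
    Fin n → Matrix (Fin (D + 1)) (Fin (D + 1)) F :=
  fun v => Matrix.of fun i j =>
    (P.exec e (input F D n r k)).1.fld 0 (((v : ℕ) * (D + 1) + i) * (D + 1) + j)

/-- The running time on input `(D, n, r, k)`. -/
noncomputable def time (P : Prog) (e : ℕ → F) (D n r k : ℕ) : ℕ :=
  (P.exec e (input F D n r k)).2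

end Prog

/-- `e` lists elements of `F` without repetition: it lists the whole field as
`e 0, …, e (|F| - 1)` if `F` is finite, and it is an injective sequence if `F` is infinite. -/
def IsFieldListing {F : Type*} (e : ℕ → F) : Prop :=
  ∀ i j : ℕ, (i : ℕ∞) < ENat.card F → (j : ℕ∞) < ENat.card F → e i = e j → i = j

/-- Given the parameters `D, n, r` and an index `k < M`, the program `P` computes within time `t`
the element of `H` with index `k`, and every element of `H` has an index. In particular
`H` has at most `M` elements. -/
def IsExplicitVia {F : Type*} [Field F] (P : Prog) (e : ℕ → F) (t : ℕ) (D n r M : ℕ)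
    (H : Set (Fin n → Matrix (Fin (D + 1)) (Fin (D + 1)) F)) : Prop :=
  H = {x | ∃ k < M, P.output e D n r k = x} ∧ ∀ k < M, P.time e D n r k ≤ t

/-! Evaluate at shift matrices whose superdiagonal entry in row `j` is the value `y j v` of variable
`v`. A monomial of length `d` contributes to the entry `(0, d)` the product of the values of its
letters, the letter at position `j` being read from `y j`. Positions thus act as separate sets of
commuting variables, and a nonzero polynomial stays nonzero for suitable unit vectors `y j`
(`exists_word_ne_zero`). The degree-`d` part of a program becomes a vector times a product of `d`
transition matrices of dimension at most `r * (D + 1)`, the `j`-th one linear in `y j`: the constant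
terms of the labels form a nilpotent matrix `C` and are absorbed through the inverse of `1 - C`
(`exists_transitions`).

It remains to hit products of `2 ^ L` matrices, each reading its own vector, after padding with
identities. This is done by recursive halving with one seed per height. At height `h` every leaf has
a curve `x ↦ y j` of degree at most `m`, and for every block of `2 ^ h` leaves the block products
along the curve, applied to the vectors reachable at its start, span those reachable at its end
(`SpansBlock`). Two neighbouring blocks would need independent points on their curves. By the rank
lemma `exists_finset_forall_mem_geomSpan`, `R` points `α, ω α, …, ω ^ (R - 1) α` already suffice on
each side, so only `R * R` pairs of points matter. The curve of height `h + 1` interpolates these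
pairs at powers of `ω`, which brings its degree back to at most `m` (`SpansBlock.merge`).

The rank lemma rests on a stabilisation argument. If the generic dimension of the span of `m`
consecutive values does not grow when one more value is added, then for generic `α` the span from `ω
α` is contained in the span from `α`. Iterating, the span from `α` contains the values at `δ + 1`
distinct points, hence by interpolation all values. Otherwise the dimension grows by one at each
step until it fills the space.

A union bound over the blocks leaves at most `2 ^ L * (R * m) < K` bad choices for each of the `L +
1` seeds, so seeds can be taken among the first `K` listed elements, which gives `K ^ (L + 1)`
tuples. For explicitness, an `ω` without small order is found by exhaustive search, the seeds are
the base-`K` digits of the index, and the curves are tabulated only at the `R` points needed for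
each leaf. The time bound follows from a structural estimate: bounded numbers, rounds and listing
indices make the running time polynomial, with one extra degree per nested loop. -/

/-! ### Polynomial functions of bounded degree. -/

open Polynomial in
/-- `f` is a polynomial function of degree at most `δ`. -/
def IsPolyFun {F : Type*} [Field F] (δ : ℕ) (f : F → F) : Prop :=
  ∃ p : F[X], p.natDegree ≤ δ ∧ ∀ x, f x = p.eval x

namespace IsPolyFun

variable {F : Type*} [Field F] {δ δ' : ℕ} {f g : F → F}

theorem const (c : F) : IsPolyFun δ (fun _ => c) :=
  ⟨Polynomial.C c, by simp, by simp⟩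

theorem mono (h : IsPolyFun δ f) (hd : δ ≤ δ') : IsPolyFun δ' f := by
  obtain ⟨p, hp, hf⟩ := h
  exact ⟨p, hp.trans hd, hf⟩

theorem add (hf : IsPolyFun δ f) (hg : IsPolyFun δ g) : IsPolyFun δ (fun x => f x + g x) := by
  obtain ⟨p, hp, hf⟩ := hf
  obtain ⟨q, hq, hg⟩ := hg
  exact ⟨p + q, (Polynomial.natDegree_add_le _ _).trans (max_le hp hq), by simp [hf, hg]⟩

theorem mul (hf : IsPolyFun δ f) (hg : IsPolyFun δ' g) :
    IsPolyFun (δ + δ') (fun x => f x * g x) := by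
  obtain ⟨p, hp, hf⟩ := hf
  obtain ⟨q, hq, hg⟩ := hg
  exact ⟨p * q, Polynomial.natDegree_mul_le.trans (add_le_add hp hq), by simp [hf, hg]⟩

theorem mul_const (hf : IsPolyFun δ f) (c : F) : IsPolyFun δ (fun x => f x * c) :=
  hf.mul (const (δ := 0) c)

theorem const_mul (hf : IsPolyFun δ f) (c : F) : IsPolyFun δ (fun x => c * f x) := by
  simpa only [mul_comm] using hf.mul_const c

theorem sum {ι : Type*} (s : Finset ι) {f : ι → F → F} (h : ∀ i ∈ s, IsPolyFun δ (f i)) :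
    IsPolyFun δ (fun x => ∑ i ∈ s, f i x) := by
  classical
  induction s using Finset.induction_on with
  | empty => simpa using const (0 : F)
  | insert a s ha ih =>
    simp only [Finset.sum_insert ha]
    exact (h a (by simp)).add (ih fun i hi => h i (by simp [hi]))

theorem prod {ι : Type*} (s : Finset ι) {f : ι → F → F} (h : ∀ i ∈ s, IsPolyFun δ (f i)) :
    IsPolyFun (s.card * δ) (fun x => ∏ i ∈ s, f i x) := by
  classical
  induction s using Finset.induction_on with
  | empty => simpa using const (1 : F)
  | insert a s ha ih =>
    simp only [Finset.prod_insert ha, Finset.card_insert_of_notMem ha]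
    exact ((h a (by simp)).mul (ih fun i hi => h i (by simp [hi]))).mono (le_of_eq (by ring))

theorem comp_const_mul (hf : IsPolyFun δ f) (c : F) : IsPolyFun δ (fun x => f (c * x)) := by
  obtain ⟨p, hp, hf⟩ := hf
  refine ⟨p.comp (Polynomial.C c * Polynomial.X), ?_, by simp [hf]⟩
  refine Polynomial.natDegree_comp_le.trans ?_
  calc _ ≤ p.natDegree * 1 := Nat.mul_le_mul_left _ ((Polynomial.natDegree_C_mul_le c _).trans Polynomial.natDegree_X_le)
    _ ≤ δ := by omega

theorem exists_finset_ne_zero (hf : IsPolyFun δ f) {x₀ : F} (h : f x₀ ≠ 0) :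
    ∃ s : Finset F, s.card ≤ δ ∧ ∀ x ∉ s, f x ≠ 0 := by
  classical
  obtain ⟨p, hp, hf⟩ := hf
  have hp0 : p ≠ 0 := by
    rintro rfl
    simp [hf] at h
  refine ⟨p.roots.toFinset, ?_, fun x hx => ?_⟩
  · exact (Multiset.toFinset_card_le _).trans ((Polynomial.card_roots' p).trans hp)
  · simpa [hp0, ← hf] using hx

theorem eq_interpolate (hf : IsPolyFun δ f) {v : ℕ → F}
    (hv : Set.InjOn v (Finset.range (δ + 1))) (x : F) :
    f x = ∑ i ∈ Finset.range (δ + 1),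
      (Lagrange.basis (Finset.range (δ + 1)) v i).eval x * f (v i) := by
  obtain ⟨p, hp, hf⟩ := hf
  have h : p = Lagrange.interpolate (Finset.range (δ + 1)) v (fun i => f (v i)) := by
    refine Lagrange.eq_interpolate_of_eval_eq _ hv ?_ (fun i _ => (hf _).symm)
    rw [Finset.card_range]
    exact lt_of_le_of_lt (Polynomial.degree_le_natDegree) (by exact_mod_cast Nat.lt_succ_of_le hp)
  rw [hf x]
  conv_lhs => rw [h]
  simp [Lagrange.interpolate_apply, Polynomial.eval_finsetSum, mul_comm]

end IsPolyFun

/-! ### Spans of polynomial vectors along a geometric progression. -/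

section Spanning

variable {F : Type*} [Field F] {ι : Type*} {δ : ℕ}

theorem mem_of_forall_node_mem {v : F → ι → F} (hv : ∀ a, IsPolyFun δ (fun x => v x a))
    {y : ℕ → F} (hy : Set.InjOn y (Finset.range (δ + 1))) (S : Submodule F (ι → F))
    (hS : ∀ i ≤ δ, v (y i) ∈ S) (x : F) : v x ∈ S := by
  have : v x = ∑ i ∈ Finset.range (δ + 1),
      (Lagrange.basis (Finset.range (δ + 1)) y i).eval x • v (y i) := by
    ext a
    simpa using (hv a).eq_interpolate hy x
  rw [this]
  exact S.sum_mem fun i hi => S.smul_mem _ (hS i (by simpa [Nat.lt_succ_iff] using hi))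

/-- Linear independence of polynomial vector functions persists outside a small set. -/
theorem exists_finset_linearIndependent [Fintype ι] {κ : Type*} [Fintype κ] {v : κ → F → ι → F}
    (hv : ∀ k a, IsPolyFun δ (fun x => v k x a)) {x₀ : F}
    (h : LinearIndependent F fun k => v k x₀) :
    ∃ s : Finset F, s.card ≤ Fintype.card κ * δ ∧
      ∀ x ∉ s, LinearIndependent F fun k => v k x := by
  classical
  have hinj : Function.Injective (Fintype.linearCombination F fun k => v k x₀) :=
    h.fintypeLinearCombination_injective
  -- Projecting by a left inverse yields a square matrix of polynomials that is the identity at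
  -- `x₀`; its determinant is a nonzero polynomial of degree at most `card κ * δ`, and its roots are
  -- the exceptions.
  obtain ⟨π, hπ⟩ := LinearMap.exists_leftInverse_of_injective _ (LinearMap.ker_eq_bot.mpr hinj)
  have hπ' : ∀ k, π (v k x₀) = Pi.single k 1 := fun k => by
    have := LinearMap.congr_fun hπ (Pi.single k 1)
    simpa [Fintype.linearCombination_apply_single] using this
  have hpoly : ∀ k k', IsPolyFun δ (fun x => π (v k x) k') := fun k k' => by
    have : (fun x => π (v k x) k') =
        fun x => ∑ a, v k x a * π (Pi.single a 1) k' := by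
      ext x
      conv_lhs => rw [pi_eq_sum_univ' (v k x)]
      simp [Finset.sum_apply]
    rw [this]
    exact IsPolyFun.sum _ fun a _ => (hv k a).mul_const _
  have hdet : IsPolyFun (Fintype.card κ * δ)
      (fun x => (Matrix.of fun k k' => π (v k x) k').det) := by
    simp only [Matrix.det_apply']
    refine IsPolyFun.sum _ fun σ _ => (IsPolyFun.const_mul ?_ _)
    exact IsPolyFun.prod Finset.univ fun i _ => hpoly _ _
  obtain ⟨s, hs, hs'⟩ := hdet.exists_finset_ne_zero (x₀ := x₀) (by
    have : (Matrix.of fun k k' => π (v k x₀) k') = (1 : Matrix κ κ F) := by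
      ext k k'
      simp [hπ', Matrix.one_apply, Pi.single_apply, eq_comm]
    simp [this])
  refine ⟨s, hs, fun x hx => ?_⟩
  have h1 := Matrix.linearIndependent_rows_of_det_ne_zero (hs' x hx)
  exact LinearIndependent.of_comp π h1

variable {β : Type*}

/-- The span of the values of a family of vector functions at `α, ω α, …, ω ^ (m - 1) α`. -/
def geomSpan (V : β → F → ι → F) (ω : F) (m : ℕ) (α : F) : Submodule F (ι → F) :=
  Submodule.span F {w | ∃ b, ∃ k < m, V b (ω ^ k * α) = w}

theorem geomSpan_mono (V : β → F → ι → F) (ω : F) {m m' : ℕ} (h : m ≤ m') (α : F) :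
    geomSpan V ω m α ≤ geomSpan V ω m' α :=
  Submodule.span_mono fun _ ⟨b, k, hk, hw⟩ => ⟨b, k, hk.trans_le h, hw⟩

theorem geomSpan_mul_le (V : β → F → ι → F) (ω : F) (m : ℕ) (α : F) :
    geomSpan V ω m (ω * α) ≤ geomSpan V ω (m + 1) α :=
  Submodule.span_mono fun _ ⟨b, k, hk, hw⟩ =>
    ⟨b, k + 1, by omega, by rw [← hw, pow_succ, mul_assoc]⟩

theorem mem_geomSpan_succ (V : β → F → ι → F) (ω : F) (m : ℕ) (α : F) (b : β) :
    V b α ∈ geomSpan V ω (m + 1) α :=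
  Submodule.subset_span ⟨b, 0, by omega, by simp⟩

variable [Fintype ι]

/-- Dimension is lower semicontinuous: a basis chosen among the generators at `α₀` stays independent
when `α₀` is replaced by a generic `α`, since rescaling the argument by `ω ^ k` does not raise the
degree. -/
theorem finrank_geomSpan_le_of_notMem {V : β → F → ι → F}
    (hV : ∀ b a, IsPolyFun δ (fun x => V b x a)) (ω : F) (m : ℕ) (α₀ : F) :
    ∃ s : Finset F, s.card ≤ Fintype.card ι * δ ∧ ∀ α ∉ s,
      Module.finrank F (geomSpan V ω m α₀) ≤ Module.finrank F (geomSpan V ω m α) := by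
  classical
  obtain ⟨T, hT, hspan, hli⟩ :=
    exists_linearIndependent F {w | ∃ b, ∃ k < m, V b (ω ^ k * α₀) = w}
  have hfin : Finite T := hli.finite
  have := Fintype.ofFinite T
  have hT' : ∀ t : T, ∃ b, ∃ k < m, V b (ω ^ k * α₀) = t := fun t => hT t.2
  choose b k hk hb using hT'
  have hcard : Fintype.card T = Module.finrank F (geomSpan V ω m α₀) := by
    rw [geomSpan, ← hspan]
    exact (finrank_span_set_eq_card hli |>.trans (by rw [Set.toFinset_card])).symm
  obtain ⟨s, hs, hs'⟩ := exists_finset_linearIndependent (δ := δ)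
    (v := fun t : T => fun x => V (b t) (ω ^ k t * x)) (x₀ := α₀)
    (fun t a => (hV (b t) a).comp_const_mul _) (by simpa [hb] using hli)
  refine ⟨s, hs.trans (Nat.mul_le_mul_right _ ?_), fun α hα => ?_⟩
  · rw [hcard]
    exact (Submodule.finrank_le _).trans (by simp)
  · rw [← hcard, ← finrank_span_eq_card (hs' α hα)]
    refine Submodule.finrank_mono (Submodule.span_le.mpr ?_)
    rintro _ ⟨t, rfl⟩
    exact Submodule.subset_span ⟨b t, k t, hk t, rfl⟩

/-- Either the maximal dimension rises when a further value is admitted, or the span has stabilised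
and already contains everything. The field must be large enough to avoid `0` and the bad sets of all
`δ + 1` shifts `ω ^ i * α` at once. -/
theorem exists_geomSpan_full {V : β → F → ι → F} (hV : ∀ b a, IsPolyFun δ (fun x => V b x a))
    {ω : F} (hω0 : ω ≠ 0) (hω : Set.InjOn (fun i => ω ^ i) (Finset.range (δ + 1)))
    (hF : ∀ s : Finset F, s.card ≤ (δ + 1) * (Fintype.card ι * δ) + 1 → ∃ x, x ∉ s) (m : ℕ) :
    (∃ α, ∀ b x, V b x ∈ geomSpan V ω m α) ∨
      ∃ α, m ≤ Module.finrank F (geomSpan V ω m α) := by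
  classical
  induction m with
  | zero => exact Or.inr ⟨0, Nat.zero_le _⟩
  | succ m ih =>
    rcases ih with ⟨α, hα⟩ | ⟨α₁, hα₁⟩
    · exact Or.inl ⟨α, fun b x => geomSpan_mono V ω (Nat.le_succ m) α (hα b x)⟩
    obtain ⟨α₀, hα₀⟩ : ∃ α₀, ∀ α, Module.finrank F (geomSpan V ω m α) ≤
        Module.finrank F (geomSpan V ω m α₀) := by
      have hbdd : BddAbove (Set.range fun α => Module.finrank F (geomSpan V ω m α)) :=
        ⟨Fintype.card ι, by
          rintro _ ⟨α, rfl⟩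
          exact (Submodule.finrank_le _).trans (by simp)⟩
      obtain ⟨α₀, h⟩ := Nat.sSup_mem (Set.range_nonempty _) hbdd
      exact ⟨α₀, fun α => (le_csSup hbdd ⟨α, rfl⟩).trans_eq h.symm⟩
    by_cases hbig : ∃ α, Module.finrank F (geomSpan V ω m α₀) <
        Module.finrank F (geomSpan V ω (m + 1) α)
    · obtain ⟨α, hα⟩ := hbig
      exact Or.inr ⟨α, lt_of_le_of_lt (hα₁.trans (hα₀ _)) hα⟩
    push Not at hbig
    obtain ⟨s, hs, hs'⟩ := finrank_geomSpan_le_of_notMem hV ω m α₀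
    -- The nonzero `α` is chosen so that every `ω ^ i * α` with `i ≤ δ` attains the maximal
    -- dimension; `α ≠ 0` keeps these points distinct for the interpolation.
    obtain ⟨α, hα⟩ := hF (insert 0 ((Finset.range (δ + 1)).biUnion fun i =>
      s.image fun x => (ω ^ i)⁻¹ * x)) (by
        refine (Finset.card_insert_le _ _).trans (Nat.succ_le_succ ?_)
        refine (Finset.card_biUnion_le_card_mul _ _ _ fun i _ =>
          Finset.card_image_le.trans hs).trans ?_
        simp)
    simp only [Finset.mem_insert, Finset.mem_biUnion, Finset.mem_range, Finset.mem_image,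
      not_or, not_exists, not_and] at hα
    obtain ⟨hα0, hα⟩ := hα
    have hgood : ∀ i ≤ δ, ω ^ i * α ∉ s := fun i hi hmem =>
      hα i (by omega) _ hmem (by rw [inv_mul_cancel_left₀ (pow_ne_zero _ hω0)])
    have heq : ∀ i ≤ δ, geomSpan V ω m (ω ^ i * α) = geomSpan V ω (m + 1) (ω ^ i * α) :=
      fun i hi => Submodule.eq_of_le_of_finrank_le (geomSpan_mono V ω (Nat.le_succ m) _)
        ((hbig _).trans (hs' _ (hgood i hi)))
    -- Stabilisation is used here: moving the start by `ω` lands in the span of `m + 1` values,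
    -- which equals the span of `m`.
    have hle : ∀ i ≤ δ, geomSpan V ω m (ω ^ i * α) ≤ geomSpan V ω m α := by
      intro i
      induction i with
      | zero => intro _; simp
      | succ i ih =>
        intro hi
        refine le_trans ?_ (ih (by omega))
        rw [heq i (by omega), pow_succ', mul_assoc]
        exact geomSpan_mul_le V ω m _
    refine Or.inl ⟨α, fun b x => geomSpan_mono V ω (Nat.le_succ m) α ?_⟩
    refine mem_of_forall_node_mem (hV b) (y := fun i => ω ^ i * α) ?_ _ (fun i hi => ?_) x
    · intro i hi j hj hij
      exact hω hi hj (mul_right_cancel₀ hα0 hij)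
    · refine hle i hi ?_
      rw [heq i hi]
      exact mem_geomSpan_succ V ω m _ b

/-- Outside a small set of values of `α`, the values of a family of vector polynomials at
`R` points of a geometric progression starting from `α` span all values. -/
theorem exists_finset_forall_mem_geomSpan {V : β → F → ι → F}
    (hV : ∀ b a, IsPolyFun δ (fun x => V b x a))
    {ω : F} (hω0 : ω ≠ 0) (hω : Set.InjOn (fun i => ω ^ i) (Finset.range (δ + 1)))
    {R : ℕ} (hR : Fintype.card ι ≤ R)
    (hF : ∀ s : Finset F, s.card ≤ (δ + 1) * (R * δ) + 1 → ∃ x, x ∉ s) :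
    ∃ s : Finset F, s.card ≤ R * δ ∧ ∀ α ∉ s, ∀ b x, V b x ∈ geomSpan V ω R α := by
  have hfull : ∃ α, ∀ b x, V b x ∈ geomSpan V ω R α := by
    rcases exists_geomSpan_full hV hω0 hω (fun s hs => hF s (hs.trans (by gcongr))) R with h | h
    · exact h
    · obtain ⟨α, hα⟩ := h
      have : geomSpan V ω R α = ⊤ := by
        apply Submodule.eq_top_of_finrank_eq
        refine le_antisymm (Submodule.finrank_le _) ?_
        rw [Module.finrank_fintype_fun_eq_card]
        omega
      exact ⟨α, fun b x => by simp [this]⟩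
  obtain ⟨α₀, hα₀⟩ := hfull
  obtain ⟨s, hs, hs'⟩ := finrank_geomSpan_le_of_notMem hV ω R α₀
  refine ⟨s, hs.trans (by gcongr), fun α hα b x => ?_⟩
  -- The span at `α₀` contains all values, so equal dimension forces the span at `α` to coincide
  -- with it.
  have hle : geomSpan V ω R α ≤ geomSpan V ω R α₀ :=
    Submodule.span_le.mpr fun _ ⟨b, k, _, hw⟩ => hw ▸ hα₀ b _
  rw [Submodule.eq_of_le_of_finrank_le hle (hs' α hα)]
  exact hα₀ b x

end Spanning

/-! ### The curves obtained by recursive interpolation. -/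

section Generator

variable {F : Type*} [Field F]

open Classical in
/-- The `q`-th Lagrange basis polynomial for the nodes `1, ω, …, ω ^ (m - 1)`. -/
noncomputable def geomBasis (ω : F) (m q : ℕ) (x : F) : F :=
  ∏ q' ∈ Finset.range m, if ω ^ q = ω ^ q' then 1 else (x - ω ^ q') * (ω ^ q - ω ^ q')⁻¹

/-- A number `q < R * R` encodes a pair of numbers; leaf `j` uses one or the other depending on
whether it lies in the left or in the right half of its block of size `2 ^ (h + 1)`. -/
def halfIndex (R h j q : ℕ) : ℕ :=
  (j / 2 ^ h % 2) * (q / R) + (1 - j / 2 ^ h % 2) * (q % R)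

/-- The curve followed by the values of the variables at leaf `j` of a block of size `2 ^ h`;
`α` lists the seeds. -/
noncomputable def leafCurve (ω : F) (m R : ℕ) (α : ℕ → F) : ℕ → ℕ → F → ℕ → F
  | 0, _, x, i => geomBasis ω m i x
  | h + 1, j, x, i => ∑ q ∈ Finset.range (R * R),
      geomBasis ω m q x * leafCurve ω m R α h j (ω ^ halfIndex R h j q * α h) i

theorem isPolyFun_geomBasis (ω : F) (m q : ℕ) : IsPolyFun m (geomBasis ω m q) := by
  classical
  have := IsPolyFun.prod (δ := 1) (Finset.range m)
    (f := fun q' x => if ω ^ q = ω ^ q' then 1 else (x - ω ^ q') * (ω ^ q - ω ^ q')⁻¹)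
    (fun q' _ => by
      split_ifs
      · exact IsPolyFun.const 1
      · refine IsPolyFun.mul_const ⟨Polynomial.X - Polynomial.C (ω ^ q'), ?_, by simp⟩ _
        exact (Polynomial.natDegree_X_sub_C _).le)
  simp only [Finset.card_range, mul_one] at this
  unfold geomBasis
  convert this

theorem geomBasis_node {ω : F} {m : ℕ} (hω : Set.InjOn (fun i => ω ^ i) (Finset.range m))
    {q q' : ℕ} (hq : q < m) (hq' : q' < m) :
    geomBasis ω m q (ω ^ q') = if q = q' then 1 else 0 := by
  classical
  have hinj : ∀ a < m, ∀ b < m, ω ^ a = ω ^ b → a = b := fun a ha b hb h =>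
    hω (by simpa using ha) (by simpa using hb) h
  unfold geomBasis
  split_ifs with h
  · subst h
    refine Finset.prod_eq_one fun i _ => ?_
    split_ifs with hi
    · rfl
    · exact mul_inv_cancel₀ (sub_ne_zero.mpr hi)
  · refine Finset.prod_eq_zero (i := q') (by simpa using hq') ?_
    rw [if_neg fun hh => h (hinj _ hq _ hq' hh)]
    simp

/-- A seed can be fixed for a new height without disturbing what was achieved below it. -/
theorem leafCurve_congr (ω : F) (m R : ℕ) {α α' : ℕ → F} {h : ℕ} (hα : ∀ l < h, α l = α' l)
    (j : ℕ) (x : F) (i : ℕ) : leafCurve ω m R α h j x i = leafCurve ω m R α' h j x i := by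
  induction h generalizing x with
  | zero => rfl
  | succ h ih =>
    simp only [leafCurve, hα h (Nat.lt_succ_self h), ih fun l hl => hα l (by omega)]

/-- The degree does not grow with the height: at each height the values of the lower curve enter
only as coefficients of the Lagrange basis. This keeps the number of bad seeds small. -/
theorem isPolyFun_leafCurve (ω : F) (m R : ℕ) (α : ℕ → F) (h j i : ℕ) :
    IsPolyFun m (fun x => leafCurve ω m R α h j x i) := by
  cases h with
  | zero => exact isPolyFun_geomBasis ω m i
  | succ h => exact IsPolyFun.sum _ fun q _ => (isPolyFun_geomBasis ω m q).mul_const _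

theorem leafCurve_zero_node {ω : F} {m : ℕ} (hω : Set.InjOn (fun i => ω ^ i) (Finset.range m))
    (R : ℕ) (α : ℕ → F) (j : ℕ) {i i' : ℕ} (hi : i < m) (hi' : i' < m) :
    leafCurve ω m R α 0 j (ω ^ i) i' = Pi.single (M := fun _ => F) i 1 i' := by
  simp only [leafCurve, geomBasis_node hω hi' hi, Pi.single_apply]

theorem leafCurve_succ_node {ω : F} {m R : ℕ}
    (hω : Set.InjOn (fun i => ω ^ i) (Finset.range m)) (hm : R * R ≤ m)
    (α : ℕ → F) (h j i : ℕ) {q : ℕ} (hq : q < R * R) :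
    leafCurve ω m R α (h + 1) j (ω ^ q) i =
      leafCurve ω m R α h j (ω ^ halfIndex R h j q * α h) i := by
  simp only [leafCurve]
  rw [Finset.sum_eq_single q]
  · rw [geomBasis_node hω (hq.trans_le hm) (hq.trans_le hm)]
    simp
  · intro b hb hbq
    rw [geomBasis_node hω ((Finset.mem_range.mp hb).trans_le hm) (hq.trans_le hm), if_neg hbq,
      zero_mul]
  · simp [hq]

end Generator

/-! ### Products of transitions and the choice of seeds. -/

section Blocks

variable {F : Type*} [Field F] {ι : Type*} [Fintype ι]

/-- A transition matrix depending affinely on the values `y 0, …, y (n - 1)`. -/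
def affineStep (n : ℕ) (C : Matrix ι ι F) (B : ℕ → Matrix ι ι F) (y : ℕ → F) : Matrix ι ι F :=
  C + ∑ i ∈ Finset.range n, y i • B i

variable [DecidableEq ι] (n : ℕ) (C : ℕ → Matrix ι ι F) (B : ℕ → ℕ → Matrix ι ι F)

/-- The product of `l` successive transition matrices, beginning with number `j₀`. -/
def blockProd (y : ℕ → ℕ → F) (j₀ : ℕ) : ℕ → Matrix ι ι F
  | 0 => 1
  | l + 1 => blockProd y j₀ l * affineStep n (C (j₀ + l)) (B (j₀ + l)) (y (j₀ + l))

/-- The vectors reachable from `a` by `j` transitions. -/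
def reachable (a : ι → F) : ℕ → Submodule F (ι → F)
  | 0 => Submodule.span F {a}
  | j + 1 => Submodule.span F {w | ∃ u ∈ reachable a j, ∃ i < n,
      Matrix.vecMul u (affineStep n (C j) (B j) (Pi.single i 1)) = w}

variable {n C B}

theorem blockProd_congr {y y' : ℕ → ℕ → F} {j₀ l : ℕ}
    (h : ∀ j, j₀ ≤ j → j < j₀ + l → ∀ i < n, y j i = y' j i) :
    blockProd n C B y j₀ l = blockProd n C B y' j₀ l := by
  induction l with
  | zero => rfl
  | succ l ih =>
    simp only [blockProd]
    rw [ih fun j h1 h2 => h j h1 (by omega)]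
    congr 1
    simp only [affineStep]
    congr 1
    exact Finset.sum_congr rfl fun i hi => by
      rw [h (j₀ + l) (by omega) (by omega) i (by simpa using hi)]

theorem blockProd_add (y : ℕ → ℕ → F) (j₀ l l' : ℕ) :
    blockProd n C B y j₀ (l + l') = blockProd n C B y j₀ l * blockProd n C B y (j₀ + l) l' := by
  induction l' with
  | zero => simp [blockProd]
  | succ l' ih => rw [← add_assoc, blockProd, ih, blockProd, mul_assoc, add_assoc]

theorem isPolyFun_blockProd {μ : ℕ} {y : F → ℕ → ℕ → F}
    (hy : ∀ j i, IsPolyFun μ (fun x => y x j i)) (j₀ l : ℕ) (s t : ι) :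
    IsPolyFun (l * μ) (fun x => blockProd n C B (y x) j₀ l s t) := by
  induction l generalizing t with
  | zero => exact IsPolyFun.const _
  | succ l ih =>
    simp only [blockProd, Matrix.mul_apply]
    refine IsPolyFun.sum _ fun u _ => ((ih u).mul (δ' := μ) ?_).mono (by rw [add_mul, one_mul])
    simp only [affineStep, Matrix.add_apply, Matrix.sum_apply, Matrix.smul_apply, smul_eq_mul]
    exact (IsPolyFun.const _).add (IsPolyFun.sum _ fun i _ => (hy _ _).mul_const _)

theorem isPolyFun_vecMul_blockProd {μ : ℕ} {y : F → ℕ → ℕ → F}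
    (hy : ∀ j i, IsPolyFun μ (fun x => y x j i)) (j₀ l : ℕ) (u : ι → F) (t : ι) :
    IsPolyFun (l * μ) (fun x => Matrix.vecMul u (blockProd n C B (y x) j₀ l) t) := by
  simp only [Matrix.vecMul, dotProduct]
  exact IsPolyFun.sum _ fun s _ => (isPolyFun_blockProd hy j₀ l s t).const_mul _

theorem vecMul_blockProd_mem_reachable (a : ι → F) {w : ℕ → ℕ} (hw : ∀ j, w j < n) (l : ℕ) :
    Matrix.vecMul a (blockProd n C B (fun j => Pi.single (w j) 1) 0 l) ∈ reachable n C B a l := by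
  induction l with
  | zero => simp [blockProd, reachable, Submodule.mem_span_singleton_self]
  | succ l ih =>
    rw [blockProd, ← Matrix.vecMul_vecMul, zero_add]
    exact Submodule.subset_span ⟨_, ih, w l, hw l, rfl⟩

variable (n C B) in
/-- The curve of height `h` spans all reachable vectors across the block number `c`. -/
def SpansBlock (a : ι → F) (ω : F) (m R : ℕ) (α : ℕ → F) (h c : ℕ) : Prop :=
  ∀ w ∈ reachable n C B a ((c + 1) * 2 ^ h), w ∈ Submodule.span F
    (Set.range fun p : reachable n C B a (c * 2 ^ h) × F => Matrix.vecMul (p.1 : ι → F)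
      (blockProd n C B (fun j => leafCurve ω m R α h j p.2) (c * 2 ^ h) (2 ^ h)))

/-- The nodes `ω ^ i` of the leaf curve give exactly the unit vectors, whose transitions generate
the reachable vectors by definition. -/
theorem spansBlock_zero (a : ι → F) {ω : F} {m : ℕ} (R : ℕ) (α : ℕ → F)
    (hω : Set.InjOn (fun i => ω ^ i) (Finset.range m)) (hn : n ≤ m) (c : ℕ) :
    SpansBlock n C B a ω m R α 0 c := by
  intro w hw
  simp only [pow_zero, mul_one] at hw ⊢
  refine Submodule.span_mono ?_ hw
  rintro _ ⟨u, hu, i, hi, rfl⟩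
  refine ⟨(⟨u, by simpa using hu⟩, ω ^ i), ?_⟩
  simp only [blockProd, add_zero, one_mul]
  congr 1
  simp only [affineStep]
  congr 1
  refine Finset.sum_congr rfl fun i' hi' => ?_
  rw [leafCurve_zero_node hω R α c (hi.trans_le hn) ((Finset.mem_range.mp hi').trans_le hn)]

/-- Seeds for which the points of a geometric progression suffice on block `c`. -/
theorem SpansBlock.exists_finset {a : ι → F} {ω : F} {m R : ℕ} {α : ℕ → F} {h c : ℕ}
    (H : SpansBlock n C B a ω m R α h c) (hω0 : ω ≠ 0)
    (hω : Set.InjOn (fun i => ω ^ i) (Finset.range (2 ^ h * m + 1)))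
    (hR : Fintype.card ι ≤ R)
    (hF : ∀ s : Finset F, s.card ≤ (2 ^ h * m + 1) * (R * (2 ^ h * m)) + 1 → ∃ x, x ∉ s) :
    ∃ s : Finset F, s.card ≤ R * (2 ^ h * m) ∧ ∀ γ ∉ s,
      reachable n C B a ((c + 1) * 2 ^ h) ≤
        geomSpan (fun (u : reachable n C B a (c * 2 ^ h)) x => Matrix.vecMul (u : ι → F)
          (blockProd n C B (fun j => leafCurve ω m R α h j x) (c * 2 ^ h) (2 ^ h))) ω R γ := by
  obtain ⟨s, hs, hs'⟩ := exists_finset_forall_mem_geomSpan (δ := 2 ^ h * m)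
    (V := fun (u : reachable n C B a (c * 2 ^ h)) x => Matrix.vecMul (u : ι → F)
      (blockProd n C B (fun j => leafCurve ω m R α h j x) (c * 2 ^ h) (2 ^ h)))
    (fun u t => isPolyFun_vecMul_blockProd (fun j i => isPolyFun_leafCurve ω m R α h j i) _ _ _ t)
    hω0 hω hR hF
  refine ⟨s, hs, fun γ hγ w hw => ?_⟩
  refine (Submodule.span_le.mpr ?_) (H w hw)
  rintro _ ⟨p, rfl⟩
  exact hs' γ hγ p.1 p.2

theorem halfIndex_left {R h c j k l : ℕ} (hk : k < R) (h1 : 2 * c * 2 ^ h ≤ j)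
    (h2 : j < 2 * c * 2 ^ h + 2 ^ h) : halfIndex R h j (l * R + k) = k := by
  have : j / 2 ^ h = 2 * c := Nat.div_eq_of_lt_le h1 (by rw [add_mul, one_mul]; exact h2)
  simp [halfIndex, this, Nat.mod_eq_of_lt hk]

theorem halfIndex_right {R h c j k l : ℕ} (hk : k < R) (h1 : (2 * c + 1) * 2 ^ h ≤ j)
    (h2 : j < (2 * c + 1) * 2 ^ h + 2 ^ h) : halfIndex R h j (l * R + k) = l := by
  have : j / 2 ^ h = 2 * c + 1 :=
    Nat.div_eq_of_lt_le h1 (by rw [add_mul _ 1, one_mul]; exact h2)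
  have h3 : (l * R + k) / R = l :=
    Nat.div_eq_of_lt_le (by omega) (by rw [add_mul, one_mul]; omega)
  have h4 : (2 * c + 1) % 2 = 1 := by omega
  simp [halfIndex, this, h3, h4]

/-- The node number `l * R + k` evaluates the left half at `ω ^ k * α h` and the right half at `ω ^
l * α h`, so all pairs of points occur. The vectors at the middle are expanded by `hleft`, those at
the end by `hright`. -/
theorem SpansBlock.merge {a : ι → F} {ω : F} {m R : ℕ} {α : ℕ → F} {h c : ℕ}
    (hω : Set.InjOn (fun i => ω ^ i) (Finset.range m)) (hm : R * R ≤ m)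
    (hleft : reachable n C B a ((2 * c + 1) * 2 ^ h) ≤
      geomSpan (fun (u : reachable n C B a (2 * c * 2 ^ h)) x => Matrix.vecMul (u : ι → F)
        (blockProd n C B (fun j => leafCurve ω m R α h j x) (2 * c * 2 ^ h) (2 ^ h))) ω R (α h))
    (hright : reachable n C B a ((2 * c + 1 + 1) * 2 ^ h) ≤
      geomSpan (fun (u : reachable n C B a ((2 * c + 1) * 2 ^ h)) x => Matrix.vecMul (u : ι → F)
        (blockProd n C B (fun j => leafCurve ω m R α h j x) ((2 * c + 1) * 2 ^ h) (2 ^ h)))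
          ω R (α h)) :
    SpansBlock n C B a ω m R α (h + 1) c := by
  have e0 : c * 2 ^ (h + 1) = 2 * c * 2 ^ h := by ring
  have e1 : (2 * c + 1) * 2 ^ h = 2 * c * 2 ^ h + 2 ^ h := by ring
  have e2 : (c + 1) * 2 ^ (h + 1) = (2 * c + 1 + 1) * 2 ^ h := by ring
  have e3 : 2 ^ (h + 1) = 2 ^ h + 2 ^ h := by ring
  intro w hw
  rw [e2] at hw
  refine (Submodule.span_le.mpr ?_) (hright hw)
  rintro _ ⟨⟨u₁, hu₁⟩, l, hl, rfl⟩
  -- For a fixed point on the right half, the middle vectors with image in the target span form a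
  -- submodule; it suffices to test the generators coming from the left half.
  have key : geomSpan (fun (u : reachable n C B a (2 * c * 2 ^ h)) x => Matrix.vecMul (u : ι → F)
        (blockProd n C B (fun j => leafCurve ω m R α h j x) (2 * c * 2 ^ h) (2 ^ h))) ω R (α h) ≤
      (Submodule.span F
        (Set.range fun p : reachable n C B a (c * 2 ^ (h + 1)) × F => Matrix.vecMul (p.1 : ι → F)
          (blockProd n C B (fun j => leafCurve ω m R α (h + 1) j p.2) (c * 2 ^ (h + 1))
            (2 ^ (h + 1))))).comap (Matrix.vecMulLinear (blockProd n C B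
              (fun j => leafCurve ω m R α h j (ω ^ l * α h)) ((2 * c + 1) * 2 ^ h) (2 ^ h))) := by
    refine Submodule.span_le.mpr ?_
    rintro _ ⟨⟨u₀, hu₀⟩, k, hk, rfl⟩
    have hq : l * R + k < R * R := by
      calc l * R + k < l * R + R := by omega
        _ = (l + 1) * R := by ring
        _ ≤ R * R := Nat.mul_le_mul_right _ hl
    refine Submodule.subset_span ⟨(⟨u₀, e0 ▸ hu₀⟩, ω ^ (l * R + k)), ?_⟩
    simp only [Matrix.coe_vecMulLinear, Matrix.vecMul_vecMul]
    congr 1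
    rw [e0, e3, blockProd_add, ← e1]
    congr 1
    · refine blockProd_congr fun j h1 h2 i _ => ?_
      rw [leafCurve_succ_node hω hm α h j i hq, halfIndex_left hk h1 h2]
    · refine blockProd_congr fun j h1 h2 i _ => ?_
      rw [leafCurve_succ_node hω hm α h j i hq, halfIndex_right hk h1 h2]
  exact key (hleft hu₁)

theorem exists_lt_notMem {F : Type*} {e : ℕ → F} {K : ℕ} (he : Set.InjOn e (Finset.range K))
    {s : Finset F} (hs : s.card < K) : ∃ i < K, e i ∉ s := by
  classical
  by_contra! h
  have : ((Finset.range K).image e).card ≤ s.card := Finset.card_le_card fun x hx => by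
    obtain ⟨i, hi, rfl⟩ := Finset.mem_image.mp hx
    exact h i (by simpa using hi)
  rw [Finset.card_image_of_injOn he, Finset.card_range] at this
  omega

variable {a : ι → F} {ω : F} {m R L K : ℕ} {e : ℕ → F}

/-- One seed has to serve all blocks of a height simultaneously. There are `2 ^ (L - h)` blocks with
at most `R * (2 ^ h * m)` bad seeds each, a total of `2 ^ L * (R * m)` independent of the height. -/
theorem exists_seeds_spansBlock (hω0 : ω ≠ 0)
    (hω : Set.InjOn (fun i => ω ^ i) (Finset.range (2 ^ L * m + 1)))
    (hR : Fintype.card ι ≤ R) (hm : R * R ≤ m) (hn : n ≤ m)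
    (hF : ∀ s : Finset F, s.card ≤ (2 ^ L * m + 1) * (R * (2 ^ L * m)) + 1 → ∃ x, x ∉ s)
    (he : Set.InjOn e (Finset.range K)) (hK : 2 ^ L * (R * m) < K) {h : ℕ} (hL : h ≤ L) :
    ∃ d : ℕ → ℕ, (∀ i, d i < K) ∧
      ∀ c < 2 ^ (L - h), SpansBlock n C B a ω m R (fun i => e (d i)) h c := by
  classical
  have hωm : Set.InjOn (fun i => ω ^ i) (Finset.range m) := hω.mono fun i hi => by
    have : 1 * m ≤ 2 ^ L * m := Nat.mul_le_mul_right _ Nat.one_le_two_pow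
    simp only [Finset.coe_range, Set.mem_Iio] at hi ⊢
    omega
  induction h with
  | zero => exact ⟨fun _ => 0, fun _ => (Nat.zero_le _).trans_lt hK, fun c _ => spansBlock_zero a R _ hωm hn c⟩
  | succ h ih =>
    obtain ⟨d, hd, hspan⟩ := ih (by omega)
    have hpow : 2 ^ h * m ≤ 2 ^ L * m :=
      Nat.mul_le_mul_right _ (Nat.pow_le_pow_right (by norm_num) (by omega))
    have hbad : ∀ c, ∃ s : Finset F, c < 2 ^ (L - h) → s.card ≤ R * (2 ^ h * m) ∧ ∀ γ ∉ s,
        reachable n C B a ((c + 1) * 2 ^ h) ≤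
          geomSpan (fun (u : reachable n C B a (c * 2 ^ h)) x => Matrix.vecMul (u : ι → F)
            (blockProd n C B (fun j => leafCurve ω m R (fun i => e (d i)) h j x)
              (c * 2 ^ h) (2 ^ h))) ω R γ := by
      intro c
      by_cases hc : c < 2 ^ (L - h)
      · obtain ⟨s, hs⟩ := (hspan c hc).exists_finset hω0
          (hω.mono fun i hi => by
            simp only [Finset.coe_range, Set.mem_Iio] at hi ⊢
            omega) hR
          (fun s hs => hF s (hs.trans (by gcongr)))
        exact ⟨s, fun _ => hs⟩
      · exact ⟨∅, fun hc' => absurd hc' hc⟩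
    choose s hs using hbad
    obtain ⟨i₀, hi₀, hgood⟩ := exists_lt_notMem he
      (s := (Finset.range (2 ^ (L - h))).biUnion s) (by
        refine lt_of_le_of_lt (Finset.card_biUnion_le_card_mul _ _ (R * (2 ^ h * m))
          fun c hc => (hs c (by simpa using hc)).1) ?_
        rw [Finset.card_range]
        refine lt_of_le_of_lt (le_of_eq ?_) hK
        have : 2 ^ L = 2 ^ (L - h) * 2 ^ h := by rw [← pow_add]; congr 1; omega
        rw [this]
        ring)
    simp only [Finset.mem_biUnion, Finset.mem_range, not_exists, not_and] at hgood
    -- Only the seed at position `h` is changed, so the curves of height `h` are unaffected.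
    have hlow : ∀ l < h, e (d l) = e (Function.update d h i₀ l) := fun l hl => by
      rw [Function.update_of_ne (by omega)]
    have hcurve : ∀ x, (fun j => leafCurve ω m R (fun i => e (Function.update d h i₀ i)) h j x) =
        fun j => leafCurve ω m R (fun i => e (d i)) h j x := fun x =>
      funext fun j => funext fun i => (leafCurve_congr ω m R hlow j x i).symm
    refine ⟨Function.update d h i₀, fun i => ?_, fun c hc => ?_⟩
    · by_cases hi : i = h
      · subst hi; simpa using hi₀
      · simpa [Function.update_of_ne hi] using hd i
    · have hc2 : 2 * c + 1 < 2 ^ (L - h) := by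
        have : 2 ^ (L - h) = 2 * 2 ^ (L - (h + 1)) := by rw [← pow_succ']; congr 1; omega
        omega
      refine SpansBlock.merge hωm hm ?_ ?_
      · simpa only [hcurve, Function.update_self] using
          (hs (2 * c) (by omega)).2 _ (hgood (2 * c) (by omega))
      · simpa only [hcurve, Function.update_self] using
          (hs (2 * c + 1) (by omega)).2 _ (hgood (2 * c + 1) (by omega))

/-- If a product of affine transitions does not vanish at some choice of unit vectors, then it
does not vanish at the point generated from some list of seeds. -/
theorem exists_seeds_ne_zero (hω0 : ω ≠ 0)
    (hω : Set.InjOn (fun i => ω ^ i) (Finset.range (2 ^ L * m + 1)))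
    (hR : Fintype.card ι ≤ R) (hR0 : 0 < R) (hm : R * R ≤ m) (hn : n ≤ m)
    (hF : ∀ s : Finset F, s.card ≤ (2 ^ L * m + 1) * (R * (2 ^ L * m)) + 1 → ∃ x, x ∉ s)
    (he : Set.InjOn e (Finset.range K)) (hK : 2 ^ L * (R * m) < K)
    {w : ℕ → ℕ} (hw : ∀ j, w j < n) {t : ι}
    (hne : Matrix.vecMul a (blockProd n C B (fun j => Pi.single (w j) 1) 0 (2 ^ L)) t ≠ 0) :
    ∃ d : ℕ → ℕ, (∀ i, d i < K) ∧ Matrix.vecMul a (blockProd n C B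
      (fun j => leafCurve ω m R (fun i => e (d i)) L j (e (d L))) 0 (2 ^ L)) t ≠ 0 := by
  obtain ⟨d, hd, hspan⟩ := exists_seeds_spansBlock (a := a) (n := n) (C := C) (B := B)
    hω0 hω hR hm hn hF he hK le_rfl
  have hspan := hspan 0 (by simp) _
    (by simpa using vecMul_blockProd_mem_reachable (C := C) (B := B) a hw (2 ^ L))
  have hex : ∃ x, Matrix.vecMul a (blockProd n C B
      (fun j => leafCurve ω m R (fun i => e (d i)) L j x) 0 (2 ^ L)) t ≠ 0 := by
    by_contra! hall
    refine hne ?_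
    -- If coordinate `t` vanished along the whole curve, then the span would lie in the kernel of
    -- that coordinate; at position `0` the reachable vectors are just the multiples of `a`.
    have : Submodule.span F (Set.range fun p : reachable n C B a (0 * 2 ^ L) × F =>
        Matrix.vecMul (p.1 : ι → F) (blockProd n C B
          (fun j => leafCurve ω m R (fun i => e (d i)) L j p.2) (0 * 2 ^ L) (2 ^ L))) ≤
        LinearMap.ker (LinearMap.proj (R := F) (φ := fun _ : ι => F) t) := by
      refine Submodule.span_le.mpr ?_
      rintro _ ⟨⟨⟨u, hu⟩, x⟩, rfl⟩
      rw [zero_mul] at hu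
      obtain ⟨c, rfl⟩ := Submodule.mem_span_singleton.mp hu
      simp [Matrix.smul_vecMul, hall x]
    exact this hspan
  obtain ⟨x₀, hx₀⟩ := hex
  -- The last seed is the point on the top curve, chosen off the roots of a polynomial of degree at
  -- most `2 ^ L * m`.
  obtain ⟨s, hs, hs'⟩ := (isPolyFun_vecMul_blockProd (n := n) (C := C) (B := B)
    (fun j i => isPolyFun_leafCurve ω m R (fun i => e (d i)) L j i)
    0 (2 ^ L) a t).exists_finset_ne_zero hx₀
  obtain ⟨i₀, hi₀, hgood⟩ := exists_lt_notMem he (lt_of_le_of_lt hs (lt_of_le_of_lt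
    (Nat.mul_le_mul_left _ (Nat.le_mul_of_pos_left m hR0)) hK))
  refine ⟨Function.update d L i₀, fun i => ?_, ?_⟩
  · by_cases hi : i = L
    · subst hi; simpa using hi₀
    · simpa [Function.update_of_ne hi] using hd i
  · have hcurve : (fun j => leafCurve ω m R (fun i => e (Function.update d L i₀ i)) L j (e i₀)) =
        fun j => leafCurve ω m R (fun i => e (d i)) L j (e i₀) :=
      funext fun j => funext fun i => leafCurve_congr ω m R
        (fun l hl => by rw [Function.update_of_ne (by omega)]) j _ i
    simpa only [Function.update_self, hcurve] using hs' _ hgood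

end Blocks

/-! ### Path sums as matrix powers. -/

section PathSums

theorem Matrix.pow_apply_eq_sum_paths {S V : Type*} [Semiring S] [Fintype V] [DecidableEq V]
    (M : Matrix V V S) (k : ℕ) (u v : V) :
    (M ^ k) u v = ∑ p : Fin (k + 1) → V, if p 0 = u ∧ p (Fin.last k) = v then
      (List.ofFn fun i : Fin k => M (p i.castSucc) (p i.succ)).prod else 0 := by
  induction k generalizing u with
  | zero =>
    rw [← (Equiv.funUnique (Fin 1) V).symm.sum_comp]
    simp only [pow_zero, Matrix.one_apply, List.ofFn_zero, List.prod_nil, Equiv.funUnique_symm_apply,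
      uniqueElim_const]
    rw [Finset.sum_eq_single u]
    · simp
    · intro b _ hb
      simp [hb]
    · simp
  | succ k ih =>
    have hc : ∀ (x : V) (q : Fin (k + 1) → V),
        (Fin.consEquiv fun _ => V) (x, q) = (Fin.cons x q : Fin (k + 2) → V) := fun _ _ => rfl
    have hl : ∀ (x : V) (q : Fin (k + 1) → V),
        (Fin.cons x q : Fin (k + 2) → V) (Fin.last (k + 1)) = q (Fin.last k) := fun _ _ => rfl
    rw [pow_succ', Matrix.mul_apply, ← (Fin.consEquiv fun _ => V).sum_comp, Fintype.sum_prod_type]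
    symm
    rw [Finset.sum_eq_single u]
    · simp only [ih, Finset.mul_sum]
      rw [Finset.sum_comm]
      refine Finset.sum_congr rfl fun q _ => ?_
      rw [Finset.sum_eq_single (q 0)]
      · rw [hc, hl]
        simp only [Fin.cons_zero, true_and, List.ofFn_succ, Fin.castSucc_zero, Fin.cons_succ,
          List.prod_cons, mul_ite, mul_zero, Fin.castSucc_succ]
      · intro b _ hb
        simp [Ne.symm hb]
      · simp
    · intro b _ hb
      refine Finset.sum_eq_zero fun q _ => if_neg ?_
      rw [hc]
      simp [hb]
    · simp

end PathSums

/-! ### Shift matrices and the detection of monomials. -/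

section Shift

variable {F : Type*} [Field F] {n : ℕ}

/-- The tuple of matrices whose superdiagonals hold the values `y i v`. -/
def shiftTuple (n m : ℕ) (y : ℕ → ℕ → F) : Fin n → Matrix (Fin (m + 1)) (Fin (m + 1)) F :=
  fun v => Matrix.of fun i j => if (j : ℕ) = i + 1 then y i v else 0

/-- The product of the entries picked by a word, beginning at position `a`. -/
def wordWeight (y : ℕ → ℕ → F) : ℕ → List (Fin n) → F
  | _, [] => 1
  | a, v :: u => y a v * wordWeight y (a + 1) u

/-- Each factor advances the position by exactly one, so the column records the length of the word
and the row of a factor records the position of its letter. -/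
theorem prod_shiftTuple_apply {m : ℕ} (y : ℕ → ℕ → F) (u : List (Fin n)) (a b : Fin (m + 1)) :
    (u.map (shiftTuple n m y)).prod a b =
      if (b : ℕ) = a + u.length then wordWeight y a u else 0 := by
  induction u generalizing a with
  | nil => simp [Matrix.one_apply, wordWeight, Fin.ext_iff, eq_comm]
  | cons v u ih =>
    simp only [List.map_cons, List.prod_cons, Matrix.mul_apply, ih, shiftTuple, Matrix.of_apply,
      List.length_cons, wordWeight]
    by_cases ha : (a : ℕ) + 1 < m + 1
    · rw [Finset.sum_eq_single ⟨a + 1, ha⟩]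
      · simp [add_assoc, add_comm 1]
      · intro c _ hc
        rw [if_neg fun h => hc (Fin.ext h), zero_mul]
      · simp
    · rw [if_neg (by have := b.2; omega)]
      refine Finset.sum_eq_zero fun c _ => ?_
      rw [if_neg (by have := c.2; omega), zero_mul]

theorem wordWeight_single (w : ℕ → ℕ) (a : ℕ) (u : List (Fin n)) :
    wordWeight (fun j => Pi.single (M := fun _ => F) (w j) 1) a u =
      if u.map Fin.val = (List.range' a u.length).map w then 1 else 0 := by
  induction u generalizing a with
  | nil => simp [wordWeight]
  | cons v u ih =>
    simp only [wordWeight, ih, Pi.single_apply, List.map_cons, List.length_cons, List.range'_succ,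
      List.cons.injEq]
    by_cases h : (v : ℕ) = w a <;> simp [h]

/-- A nonzero non-commutative polynomial is detected by shift matrices of unit vectors. -/
theorem exists_word_ne_zero (hn : 0 < n) {f : FreeAlgebra F (Fin n)} (hf : f ≠ 0) :
    ∃ (m : ℕ) (w : ℕ → ℕ), (∀ j, w j < n) ∧
      FreeAlgebra.lift F 
        (shiftTuple n m (fun j => Pi.single (w j) 1 : ℕ → ℕ → F)) f 0 (Fin.last m) ≠ 0 := by
  classical
  by_contra! hall
  refine hf ((FreeAlgebra.basisFreeMonoid F (Fin n)).ext_elem fun u => ?_)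
  -- Beyond the end of the word the letter is `0` by default, a valid variable because `0 < n`.
  let w : ℕ → ℕ := fun j => ((u.toList.map Fin.val).getD j 0)
  have hw : ∀ j, w j < n := by
    intro j
    simp only [w, List.getD_eq_getElem?_getD, List.getElem?_map]
    cases u.toList[j]? with
    | none => simpa using hn
    | some v => simp
  let ψ : FreeAlgebra F (Fin n) →ₗ[F] F :=
    { toFun := fun g => FreeAlgebra.lift F
        (shiftTuple n u.toList.length (fun j => Pi.single (w j) 1 : ℕ → ℕ → F)) g 0 (Fin.last _)
      map_add' := by intros; simp
      map_smul' := by intros; simp }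
  -- With unit vectors spelling `u`, the corner entry of the evaluation is exactly the coefficient
  -- of `u`: the corner selects the length and the unit vectors select the letters.
  have hψ : (FreeAlgebra.basisFreeMonoid F (Fin n)).coord u = ψ := by
    refine (FreeAlgebra.basisFreeMonoid F (Fin n)).ext fun u' => ?_
    have hb : FreeAlgebra.basisFreeMonoid F (Fin n) u' =
        (u'.toList.map (FreeAlgebra.ι F)).prod := by
      change MonoidAlgebra.lift F (FreeAlgebra F (Fin n)) (FreeMonoid (Fin n))
        (FreeMonoid.lift (FreeAlgebra.ι F)) (MonoidAlgebra.single u' 1) = _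
      simp [MonoidAlgebra.lift_single, FreeMonoid.lift_apply]
    have hψ' : ψ (FreeAlgebra.basisFreeMonoid F (Fin n) u') = if u' = u then 1 else 0 := by
      have h1 : ψ (FreeAlgebra.basisFreeMonoid F (Fin n) u') =
          (u'.toList.map (shiftTuple n u.toList.length
            fun j => Pi.single (M := fun _ => F) (w j) 1)).prod 0 (Fin.last _) := by
        rw [hb]
        change FreeAlgebra.lift F (shiftTuple n u.toList.length
          (fun j => Pi.single (w j) 1 : ℕ → ℕ → F)) _ 0 (Fin.last _) = _
        rw [map_list_prod, List.map_map]
        refine congrArg (fun φ : Fin n → Matrix (Fin (u.toList.length + 1))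
          (Fin (u.toList.length + 1)) F => (List.map φ u'.toList).prod 0 (Fin.last _))
          (funext fun v => ?_)
        simp
      rw [h1, prod_shiftTuple_apply, wordWeight_single]
      have h2 : (List.range' (((0 : Fin (u.toList.length + 1))) : ℕ) u.toList.length).map w =
          u.toList.map Fin.val := by
        refine List.ext_getElem (by simp) fun i hi hi' => ?_
        simp [w, List.getD_eq_getElem?_getD] at hi hi' ⊢
        simp [hi']
      by_cases hlen : u'.toList.length = u.toList.length
      · rw [if_pos (by simp [hlen]), hlen, h2]
        have : u'.toList.map Fin.val = u.toList.map Fin.val ↔ u' = u := by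
          rw [(List.map_injective_iff.mpr Fin.val_injective).eq_iff]
          exact FreeMonoid.toList.injective.eq_iff
        simp only [this]
      · rw [if_neg (by simpa using Ne.symm hlen), if_neg (by rintro rfl; exact hlen rfl)]
    rw [hψ']
    simp [Finsupp.single_apply]
  have := LinearMap.congr_fun hψ f
  rw [Module.Basis.coord_apply] at this
  rw [this, map_zero, Finsupp.zero_apply]
  exact hall _ w hw

end Shift

/-! ### Affine labels at shift matrices. -/

section Evaluation

variable {F : Type*} [Field F] {n m : ℕ}

theorem lift_shiftTuple_affine (y : ℕ → ℕ → F) (c : F) (b : Fin n → F) :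
    FreeAlgebra.lift F (shiftTuple n m y)
        (algebraMap F (FreeAlgebra F (Fin n)) c + ∑ i, b i • FreeAlgebra.ι F i) =
      Matrix.of fun p q : Fin (m + 1) => (if p = q then c else 0) +
        if (q : ℕ) = p + 1 then ∑ i, b i * y p i else 0 := by
  ext p q
  simp only [map_add, map_sum, map_smul, FreeAlgebra.lift_ι_apply, AlgHom.commutes,
    Matrix.add_apply, Matrix.sum_apply, Matrix.smul_apply, shiftTuple, Matrix.of_apply,
    Matrix.algebraMap_matrix_apply, smul_eq_mul, Algebra.algebraMap_self, RingHom.id_apply]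
  congr 1
  split_ifs <;> simp

theorem lift_shiftTuple_mul_affine_zero (y : ℕ → ℕ → F) (g : FreeAlgebra F (Fin n)) (c : F)
    (b : Fin n → F) :
    FreeAlgebra.lift F (shiftTuple n m y)
        (g * (algebraMap F (FreeAlgebra F (Fin n)) c + ∑ i, b i • FreeAlgebra.ι F i)) 0 0 =
      FreeAlgebra.lift F (shiftTuple n m y) g 0 0 * c := by
  rw [map_mul, lift_shiftTuple_affine, Matrix.mul_apply]
  simp

/-- The constant part of the last factor keeps the degree, and its linear part raises the degree by
one, reading the values at position `d`. -/
theorem lift_shiftTuple_mul_affine_succ (y : ℕ → ℕ → F) (g : FreeAlgebra F (Fin n)) (c : F)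
    (b : Fin n → F) (d : Fin m) :
    FreeAlgebra.lift F (shiftTuple n m y)
        (g * (algebraMap F (FreeAlgebra F (Fin n)) c + ∑ i, b i • FreeAlgebra.ι F i)) 0 d.succ =
      FreeAlgebra.lift F (shiftTuple n m y) g 0 d.succ * c +
        FreeAlgebra.lift F (shiftTuple n m y) g 0 d.castSucc * ∑ i, b i * y d i := by
  rw [map_mul, lift_shiftTuple_affine, Matrix.mul_apply]
  simp only [Matrix.of_apply, mul_add, Finset.sum_add_distrib]
  congr 1
  · simp
  · rw [Finset.sum_eq_single d.castSucc]
    · simp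
    · intro p _ hp
      rw [if_neg fun h => hp (Fin.ext (by simp at h ⊢; omega)), mul_zero]
    · simp

end Evaluation

/-! ### From a branching program to a product of linear transitions. -/

namespace NCBranchingProgram

variable {F : Type*} [Field F] {n D : ℕ} (A : NCBranchingProgram F n D)

open Classical in
/-- The matrix of all labels, with zeros where there is no edge. -/
noncomputable def labelMatrix : Matrix (Fin A.size) (Fin A.size) (FreeAlgebra F (Fin n)) :=
  Matrix.of fun u v => if A.Edge u v then A.label u v else 0

theorem poly_eq_pow : A.poly = (A.labelMatrix ^ D) A.source A.sink := by
  classical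
  rw [Matrix.pow_apply_eq_sum_paths, poly, Finset.sum_filter]
  refine Finset.sum_congr rfl fun p _ => ?_
  by_cases h : ∀ i : Fin D, A.Edge (p i.castSucc) (p i.succ)
  · have : (fun i : Fin D => A.labelMatrix (p i.castSucc) (p i.succ)) =
        fun i : Fin D => A.label (p i.castSucc) (p i.succ) := by
      funext i
      simp [labelMatrix, h i]
    simp only [IsPath, h, implies_true, and_true, this]
  · have h' : (List.ofFn fun i : Fin D => A.labelMatrix (p i.castSucc) (p i.succ)).prod = 0 := by
      push Not at h
      obtain ⟨i, hi⟩ := h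
      refine List.prod_eq_zero (List.mem_ofFn.mpr ⟨i, ?_⟩)
      simp [labelMatrix, hi]
    rw [if_neg fun hp => h hp.2.2, h', ite_self]

theorem exists_labelMatrix_eq (u v : Fin A.size) : ∃ (c : F) (b : Fin n → F),
    A.labelMatrix u v = algebraMap F (FreeAlgebra F (Fin n)) c + ∑ i, b i • FreeAlgebra.ι F i ∧
      (¬ A.Edge u v → c = 0 ∧ b = 0) := by
  by_cases h : A.Edge u v
  · obtain ⟨c, b, hcb⟩ := A.label_affine u v h
    exact ⟨c, b, by simpa [labelMatrix, h] using hcb, fun h' => absurd h h'⟩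
  · exact ⟨0, 0, by simp [labelMatrix, h], fun _ => ⟨rfl, rfl⟩⟩

theorem level_eq_of_labelMatrix_pow_ne_zero {k : ℕ} {u v : Fin A.size}
    (h : (A.labelMatrix ^ k) u v ≠ 0) : (A.level v : ℕ) = A.level u + k := by
  induction k generalizing v with
  | zero =>
    by_cases huv : u = v
    · subst huv; rfl
    · simp [huv] at h
  | succ k ih =>
    rw [pow_succ, Matrix.mul_apply] at h
    obtain ⟨x, -, hx⟩ := Finset.exists_ne_zero_of_sum_ne_zero h
    have h1 := ih (left_ne_zero_of_mul hx)
    have h2 : A.Edge x v := by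
      by_contra hn
      exact right_ne_zero_of_mul hx (by simp [labelMatrix, hn])
    rw [A.edge_level x v h2, h1]
    omega

/-- The sum over all paths from the source to a vertex. -/
noncomputable def prefixPoly (v : Fin A.size) : FreeAlgebra F (Fin n) :=
  (A.labelMatrix ^ (A.level v : ℕ)) A.source v

theorem level_source : (A.level A.source : ℕ) = 0 := by
  rw [(A.level_eq_zero_iff _).mpr rfl]; rfl

theorem level_sink : (A.level A.sink : ℕ) = D := by
  rw [(A.level_eq_last_iff _).mpr rfl]; rfl

theorem prefixPoly_sink : A.prefixPoly A.sink = A.poly := by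
  rw [prefixPoly, level_sink, poly_eq_pow]

/-- Summing over all vertices instead of the preceding level gives one recursion for all levels,
which is needed to solve for a homogeneous component with a single matrix inverse. The extra terms
vanish because edges raise the level by one. -/
theorem prefixPoly_eq (v : Fin A.size) :
    A.prefixPoly v = (if v = A.source then 1 else 0) +
      ∑ u, A.prefixPoly u * A.labelMatrix u v := by
  have hterm : ∀ u, A.prefixPoly u * A.labelMatrix u v ≠ 0 →
      (A.level v : ℕ) = A.level u + 1 := fun u hu => by
    have := right_ne_zero_of_mul hu
    rw [← pow_one A.labelMatrix] at this
    exact A.level_eq_of_labelMatrix_pow_ne_zero this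
  by_cases hv : v = A.source
  · subst hv
    rw [if_pos rfl, Finset.sum_eq_zero fun u _ => ?_, prefixPoly, level_source]
    · simp
    · by_contra hu
      have := hterm u hu
      rw [level_source] at this
      omega
  · rw [if_neg hv, zero_add]
    have hpos : (A.level v : ℕ) ≠ 0 := fun h =>
      hv ((A.level_eq_zero_iff v).mp (Fin.ext h))
    obtain ⟨k, hk⟩ := Nat.exists_eq_succ_of_ne_zero hpos
    rw [prefixPoly, hk, pow_succ, Matrix.mul_apply]
    refine Finset.sum_congr rfl fun u _ => ?_
    by_cases huv : A.labelMatrix u v = 0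
    · simp [huv]
    · have := A.level_eq_of_labelMatrix_pow_ne_zero (k := 1) (by rwa [pow_one])
      rw [prefixPoly, show (A.level u : ℕ) = k by omega]

/-- Each edge contributes degree at most one, so `k` edges cannot reach a position beyond `k`. -/
theorem lift_prefix_eq_zero {m : ℕ} (y : ℕ → ℕ → F) (k : ℕ) (v : Fin A.size) (d : Fin (m + 1))
    (hd : k < d) :
    FreeAlgebra.lift F (shiftTuple n m y) ((A.labelMatrix ^ k) A.source v) 0 d = 0 := by
  induction k generalizing v d with
  | zero =>
    have : (0 : Fin (m + 1)) ≠ d := fun h => by simp [← h] at hd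
    by_cases hv : A.source = v <;> simp [hv, this]
  | succ k ih =>
    obtain ⟨d, rfl⟩ := Fin.exists_succ_eq.mpr (show d ≠ 0 from fun h => by simp [h] at hd)
    rw [pow_succ, Matrix.mul_apply, map_sum, Matrix.sum_apply]
    refine Finset.sum_eq_zero fun u _ => ?_
    obtain ⟨c, b, hcb, -⟩ := A.exists_labelMatrix_eq u v
    simp only [Fin.val_succ] at hd
    rw [hcb, lift_shiftTuple_mul_affine_succ, ih u _ (by simp; omega), ih u _ (by simp; omega)]
    simp

/-- Homogeneous components of the computed polynomial, evaluated on shift matrices, are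
products of transition matrices that are linear in the variables. -/
theorem exists_transitions : ∃ (a : Fin A.size → F) (B : ℕ → Matrix (Fin A.size) (Fin A.size) F),
    ∀ (m : ℕ) (y : ℕ → ℕ → F) (d : Fin (m + 1)),
      FreeAlgebra.lift F (shiftTuple n m y) A.poly 0 d =
        Matrix.vecMul a (blockProd n (fun _ => 0) (fun _ => B) y 0 d) A.sink := by
  classical
  choose c b hcb hedge using A.exists_labelMatrix_eq
  let C : Matrix (Fin A.size) (Fin A.size) F := Matrix.of c
  let Lm : ℕ → Matrix (Fin A.size) (Fin A.size) F :=
    fun i => Matrix.of fun u v => if hi : i < n then b u v ⟨i, hi⟩ else 0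
  -- A nonzero entry of `C ^ k` requires a level difference of `k`, which is at most `D`.
  have hC : IsNilpotent C := by
    refine ⟨D + 1, ?_⟩
    have hpow : ∀ k u v, (C ^ k) u v ≠ 0 → (A.level v : ℕ) = A.level u + k := by
      intro k
      induction k with
      | zero =>
        intro u v h
        by_cases huv : u = v
        · subst huv; rfl
        · simp [huv] at h
      | succ k ih =>
        intro u v h
        rw [pow_succ, Matrix.mul_apply] at h
        obtain ⟨x, -, hx⟩ := Finset.exists_ne_zero_of_sum_ne_zero h
        have h2 : A.Edge x v := by
          by_contra hn
          exact right_ne_zero_of_mul hx (hedge x v hn).1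
        rw [A.edge_level x v h2, ih u x (left_ne_zero_of_mul hx)]
        omega
    ext u v
    by_contra h
    have := hpow _ u v h
    have := (A.level v).2
    omega
  obtain ⟨S, hS⟩ := hC.isUnit_one_sub.exists_right_inv
  refine ⟨Matrix.vecMul (Pi.single A.source 1) S, fun i => Lm i * S, fun m y => ?_⟩
  let σ : Fin (m + 1) → Fin A.size → F :=
    fun d v => FreeAlgebra.lift F (shiftTuple n m y) (A.prefixPoly v) 0 d
  -- Components of equal degree refer to each other only through `C`, so the equation `x (1 - C) =
  -- z` determines `x` from the component of lower degree.
  have hinv : ∀ x z : Fin A.size → F, x = z + Matrix.vecMul x C → x = Matrix.vecMul z S := by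
    intro x z h
    have : z = Matrix.vecMul x (1 - C) := by
      rw [Matrix.vecMul_sub, Matrix.vecMul_one]
      exact eq_sub_of_add_eq h.symm
    rw [this, Matrix.vecMul_vecMul, hS, Matrix.vecMul_one]
  have h0 : σ 0 = Matrix.vecMul (Pi.single A.source 1) S := by
    refine hinv _ _ (funext fun v => ?_)
    simp only [σ]
    conv_lhs => rw [A.prefixPoly_eq v]
    rw [map_add, map_sum, Matrix.add_apply, Matrix.sum_apply]
    simp only [hcb, lift_shiftTuple_mul_affine_zero]
    rw [Pi.add_apply]
    congr 1
    by_cases hv : v = A.source <;> simp [hv]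
  have hsucc : ∀ d : Fin m, σ d.succ = Matrix.vecMul (σ d.castSucc)
      (affineStep n 0 (fun i => Lm i * S) (y d)) := by
    intro d
    have : affineStep n 0 (fun i => Lm i * S) (y d) =
        (∑ i ∈ Finset.range n, y d i • Lm i) * S := by
      simp [affineStep, Finset.sum_mul]
    rw [this, ← Matrix.vecMul_vecMul]
    refine hinv _ _ (funext fun v => ?_)
    simp only [σ]
    conv_lhs => rw [A.prefixPoly_eq v]
    rw [map_add, map_sum, Matrix.add_apply, Matrix.sum_apply]
    simp only [hcb, lift_shiftTuple_mul_affine_succ]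
    have hz : FreeAlgebra.lift F (shiftTuple n m y)
        (if v = A.source then 1 else 0) 0 d.succ = 0 := by
      by_cases hv : v = A.source <;> simp [hv, (Fin.succ_ne_zero d).symm]
    rw [hz, zero_add, Finset.sum_add_distrib, add_comm, Pi.add_apply]
    congr 1
    simp only [Matrix.vecMul, dotProduct, Matrix.sum_apply, Matrix.smul_apply, smul_eq_mul]
    refine Finset.sum_congr rfl fun u _ => ?_
    rw [Finset.sum_range]
    congr 1
    refine Finset.sum_congr rfl fun i _ => ?_
    simp [Lm, mul_comm]
  have hall : ∀ d : Fin (m + 1), σ d = Matrix.vecMul (Matrix.vecMul (Pi.single A.source 1) S)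
      (blockProd n (fun _ => 0) (fun _ i => Lm i * S) y 0 d) := by
    intro d
    induction d using Fin.induction with
    | zero => simp [blockProd, h0]
    | succ d ih =>
      rw [hsucc, ih, Matrix.vecMul_vecMul, Fin.val_succ, blockProd, zero_add]
      rfl
  intro d
  rw [← A.prefixPoly_sink]
  exact congrFun (hall d) A.sink

/-- There are `D + 1` levels. The transition matrices act on all vertices at once, so this total,
not the width alone, is the dimension that `R` must dominate. -/
theorem size_le {r : ℕ} (h : A.width ≤ r) : A.size ≤ r * (D + 1) := by
  classical
  have h1 : ∀ i ∈ (Finset.univ : Finset (Fin (D + 1))),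
      (Finset.univ.filter fun v : Fin A.size => A.level v = i).card ≤ r := fun i hi =>
    (Finset.le_sup (f := fun i : Fin (D + 1) =>
      (Finset.univ.filter fun v : Fin A.size => A.level v = i).card) hi).trans h
  have h2 := Finset.card_le_mul_card_image_of_maps_to (f := A.level)
    (s := Finset.univ) (t := Finset.univ) (fun _ _ => Finset.mem_univ _) r h1
  simpa using h2

end NCBranchingProgram

/-! ### Detection by generated tuples. -/

/-- The values of the variables generated from the seeds `α 0, …, α L` for each leaf. -/
noncomputable def generatedValues {F : Type*} [Field F] (ω : F) (m R L : ℕ) (α : ℕ → F) :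
    ℕ → ℕ → F :=
  fun j => leafCurve ω m R α L j (α L)

/-- Some generated tuple of matrices detects a nonzero polynomial with a small program. -/
theorem exists_seeds_lift_ne_zero {F : Type*} [Field F] {n r D L m R K : ℕ} {ω : F} {e : ℕ → F}
    (hn0 : 0 < n) (hr0 : 0 < r) (hL : D ≤ 2 ^ L) (hω0 : ω ≠ 0)
    (hω : Set.InjOn (fun i => ω ^ i) (Finset.range (2 ^ L * m + 1)))
    (hR : r * (D + 1) ≤ R) (hm : R * R ≤ m) (hn : n ≤ m)
    (hF : ∀ s : Finset F, s.card ≤ (2 ^ L * m + 1) * (R * (2 ^ L * m)) + 1 → ∃ x, x ∉ s)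
    (he : Set.InjOn e (Finset.range K)) (hK : 2 ^ L * (R * m) < K)
    {f : FreeAlgebra F (Fin n)} (hf : f ∈ NCABPClass F n r D) (hf0 : f ≠ 0) :
    ∃ d : ℕ → ℕ, (∀ i, d i < K) ∧ FreeAlgebra.lift F
      (shiftTuple n D (generatedValues ω m R L fun i => e (d i))) f ≠ 0 := by
  classical
  obtain ⟨A, hA, rfl⟩ := hf
  obtain ⟨a, B, hB⟩ := A.exists_transitions
  obtain ⟨d, w, hw, hne⟩ := exists_word_ne_zero hn0 hf0
  have hd : d ≤ D := by
    by_contra hlt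
    refine hne ?_
    rw [A.poly_eq_pow]
    exact A.lift_prefix_eq_zero _ _ _ _ (by simpa using hlt)
  -- Positions from `d` on carry the identity transition, so that the product has length exactly `2
  -- ^ L` without changing its value.
  let C' : ℕ → Matrix (Fin A.size) (Fin A.size) F := fun j => if j < d then 0 else 1
  let B' : ℕ → ℕ → Matrix (Fin A.size) (Fin A.size) F := fun j i => if j < d then B i else 0
  have hpad : ∀ (y : ℕ → ℕ → F) (l : ℕ), blockProd n C' B' y 0 (d + l) =
      blockProd n (fun _ => 0) (fun _ => B) y 0 d := by
    intro y l
    induction l with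
    | zero =>
      have : ∀ l ≤ d, blockProd n C' B' y 0 l = blockProd n (fun _ => 0) (fun _ => B) y 0 l := by
        intro l
        induction l with
        | zero => intro _; rfl
        | succ l ih =>
          intro hl
          have hl' : l < d := hl
          rw [blockProd, blockProd, ih hl'.le]
          congr 1
          simp [affineStep, C', B', hl']
      exact this d le_rfl
    | succ l ih =>
      rw [← add_assoc, blockProd, ih]
      have : affineStep n (C' (0 + (d + l))) (B' (0 + (d + l))) (y (0 + (d + l))) = 1 := by
        simp [affineStep, C', B']
      rw [this, mul_one]
  obtain ⟨l, hl⟩ := Nat.exists_eq_add_of_le (hd.trans hL)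
  rw [hB, Fin.val_last, ← hpad _ l, ← hl] at hne
  obtain ⟨s, hs, hne'⟩ := exists_seeds_ne_zero hω0 hω
    (by simpa using (A.size_le hA).trans hR)
    (lt_of_lt_of_le (by positivity) hR) hm hn hF he hK hw hne
  refine ⟨s, hs, fun h0 => hne' ?_⟩
  have := hB D (generatedValues ω m R L fun i => e (s i)) ⟨d, by omega⟩
  rw [h0] at this
  rw [hl, hpad]
  exact this.symm

/-! ### Bit lengths and costs of expressions. -/

section SizeBounds

theorem Nat.size_le_self (v : ℕ) : v.size ≤ v :=
  Nat.size_le.mpr Nat.lt_two_pow_self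

theorem Nat.size_add_le (x y : ℕ) : (x + y).size ≤ x.size + y.size + 1 := by
  have hx := Nat.lt_size_self x
  have hy := Nat.lt_size_self y
  have h1 : 2 ^ x.size ≤ 2 ^ (x.size + y.size) := Nat.pow_le_pow_right (by norm_num) (by omega)
  have h2 : 2 ^ y.size ≤ 2 ^ (x.size + y.size) := Nat.pow_le_pow_right (by norm_num) (by omega)
  exact Nat.size_le.mpr (by rw [pow_succ]; omega)

theorem Nat.size_mul_le (x y : ℕ) : (x * y).size ≤ x.size + y.size :=
  Nat.size_le.mpr (by
    rw [pow_add]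
    exact Nat.mul_lt_mul'' (Nat.lt_size_self x) (Nat.lt_size_self y))

end SizeBounds

/-- All natural numbers in the memory have bit length at most `B`. -/
def Memory.NatBounded {F : Type*} (B : ℕ) (s : Memory F) : Prop :=
  ∀ a i, (s.nat a i).size ≤ B

namespace Memory

variable {F : Type*} (s : Memory F)

@[simp] theorem setNat_nat (a i v b j : ℕ) :
    (s.setNat a i v).nat b j = if b = a ∧ j = i then v else s.nat b j := by
  by_cases h : b = a
  · subst h
    simp [setNat, Function.update_apply]
  · simp [setNat, h]

@[simp] theorem setNat_fld (a i v : ℕ) : (s.setNat a i v).fld = s.fld := rfl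

@[simp] theorem setFld_fld (a i : ℕ) (v : F) (b j : ℕ) :
    (s.setFld a i v).fld b j = if b = a ∧ j = i then v else s.fld b j := by
  by_cases h : b = a
  · subst h
    simp [setFld, Function.update_apply]
  · simp [setFld, h]

@[simp] theorem setFld_nat (a i : ℕ) (v : F) : (s.setFld a i v).nat = s.nat := rfl

variable {s}

theorem NatBounded.setNat {B : ℕ} (hs : s.NatBounded B) (a i : ℕ) {v : ℕ} (hv : v.size ≤ B) :
    (s.setNat a i v).NatBounded B := by
  intro b j
  rw [setNat_nat]
  split_ifs
  · exact hv
  · exact hs b j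

end Memory

namespace NatExpr

variable {F : Type*}

/-- A coefficient in the bound of the cost of an expression. -/
def weight : NatExpr → ℕ
  | const c => 1 + c.size
  | get _ i => 2 * i.weight + 1
  | add x y => 2 * x.weight + 2 * y.weight + 1
  | sub x y => 2 * x.weight + 2 * y.weight + 1
  | mul x y => 2 * x.weight + 2 * y.weight + 1
  | div x y => 2 * x.weight + 2 * y.weight + 1
  | mod x y => 2 * x.weight + 2 * y.weight + 1

/-- Sums and products at most add up bit lengths, apart from one carry bit, and stored entries are
bounded by hypothesis. Size and cost are bounded together because the cost of an operation involves
the sizes of its operands. -/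
theorem size_eval_le_and_cost_le {B : ℕ} {s : Memory F} (hs : s.NatBounded B) (x : NatExpr) :
    (x.eval s).size ≤ x.weight * (B + 1) ∧ x.cost s ≤ x.weight * (B + 1) := by
  induction x with
  | const c =>
    have : (1 + c.size) * 1 ≤ (1 + c.size) * (B + 1) := Nat.mul_le_mul_left _ (by omega)
    simp only [eval, cost, weight]
    omega
  | get a i ih =>
    have := hs a (i.eval s)
    simp only [eval, cost, weight]
    rw [add_mul, mul_assoc, one_mul]
    omega
  | add x y ihx ihy =>
    have := Nat.size_add_le (x.eval s) (y.eval s)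
    simp only [eval, cost, weight]
    rw [add_mul, add_mul, mul_assoc, mul_assoc, one_mul]
    omega
  | sub x y ihx ihy =>
    have := Nat.size_le_size (Nat.sub_le (x.eval s) (y.eval s))
    simp only [eval, cost, weight]
    rw [add_mul, add_mul, mul_assoc, mul_assoc, one_mul]
    omega
  | mul x y ihx ihy =>
    have := Nat.size_mul_le (x.eval s) (y.eval s)
    simp only [eval, cost, weight]
    rw [add_mul, add_mul, mul_assoc, mul_assoc, one_mul]
    omega
  | div x y ihx ihy =>
    have := Nat.size_le_size (Nat.div_le_self (x.eval s) (y.eval s))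
    simp only [eval, cost, weight]
    rw [add_mul, add_mul, mul_assoc, mul_assoc, one_mul]
    omega
  | mod x y ihx ihy =>
    have := Nat.size_le_size (Nat.mod_le (x.eval s) (y.eval s))
    simp only [eval, cost, weight]
    rw [add_mul, add_mul, mul_assoc, mul_assoc, one_mul]
    omega

end NatExpr

namespace FieldExpr

variable {F : Type*}

/-- A coefficient in the bound of the cost of an expression. -/
def weight : FieldExpr → ℕ
  | zero => 1
  | one => 1
  | get _ i => 2 * i.weight + 1
  | enum i => i.weight + 1
  | add x y => x.weight + y.weight + 1
  | sub x y => x.weight + y.weight + 1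
  | mul x y => x.weight + y.weight + 1
  | inv x => x.weight + 1

/-- Only the first `B + 1` elements of the listing are requested. -/
def Safe (B : ℕ) (s : Memory F) : FieldExpr → Prop
  | zero => True
  | one => True
  | get _ _ => True
  | enum i => i.eval s ≤ B
  | add x y => x.Safe B s ∧ y.Safe B s
  | sub x y => x.Safe B s ∧ y.Safe B s
  | mul x y => x.Safe B s ∧ y.Safe B s
  | inv x => x.Safe B s

theorem cost_le {B : ℕ} {s : Memory F} (hs : s.NatBounded B) {x : FieldExpr} (hx : x.Safe B s) :
    x.cost s ≤ x.weight * (B + 1) := by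
  induction x with
  | zero => simp [cost, weight]
  | one => simp [cost, weight]
  | get a i =>
    have := i.size_eval_le_and_cost_le hs
    simp only [cost, weight]
    rw [add_mul, mul_assoc, one_mul]
    omega
  | enum i =>
    have := i.size_eval_le_and_cost_le hs
    simp only [cost, weight, Safe] at hx ⊢
    rw [add_mul, one_mul]
    omega
  | add x y ihx ihy =>
    have := ihx hx.1
    have := ihy hx.2
    simp only [cost, weight]
    rw [add_mul, add_mul, one_mul]
    omega
  | sub x y ihx ihy =>
    have := ihx hx.1
    have := ihy hx.2
    simp only [cost, weight]
    rw [add_mul, add_mul, one_mul]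
    omega
  | mul x y ihx ihy =>
    have := ihx hx.1
    have := ihy hx.2
    simp only [cost, weight]
    rw [add_mul, add_mul, one_mul]
    omega
  | inv x ih =>
    have := ih hx
    simp only [cost, weight]
    rw [add_mul, one_mul]
    omega

end FieldExpr

/-! ### Running time and rules for reasoning about programs. -/

namespace Prog

variable {F : Type*} [Field F] {e : ℕ → F} {B : ℕ}

/-- The memory after the first `j` rounds of a loop with counter `a` and body `c`. -/
noncomputable def loopState (e : ℕ → F) (a : ℕ) (c : Prog) (s : Memory F) : ℕ → Memory F
  | 0 => s
  | j + 1 => (exec e c ((loopState e a c s j).setNat a 0 j)).1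

/-- The time taken by the first `j` rounds of a loop. -/
noncomputable def loopTime (e : ℕ → F) (a : ℕ) (c : Prog) (s : Memory F) : ℕ → ℕ
  | 0 => 0
  | j + 1 => loopTime e a c s j + 1 + j.size +
      (exec e c ((loopState e a c s j).setNat a 0 j)).2

theorem exec_loop (a : ℕ) (b : NatExpr) (c : Prog) (s : Memory F) :
    exec e (loop a b c) s = (loopState e a c s (b.eval s),
      b.cost s + 1 + (b.eval s).size + loopTime e a c s (b.eval s)) := by
  have key : ∀ k t₀, (Nat.rec (motive := fun _ => Memory F × ℕ) (s, t₀)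
        (fun j p => ((exec e c (p.1.setNat a 0 j)).1,
          p.2 + 1 + j.size + (exec e c (p.1.setNat a 0 j)).2)) k) =
      (loopState e a c s k, t₀ + loopTime e a c s k) := by
    intro k t₀
    induction k with
    | zero => rfl
    | succ k ih => simp only [ih, loopState, loopTime]; simp only [Prod.mk.injEq, true_and]; ring
  exact key _ _

/-- The numbers stored during the execution have bit length at most `B`, loops have at most `B`
rounds, and only the first `B + 1` elements of the listing are requested. -/
def Safe (e : ℕ → F) (B : ℕ) : Prog → Memory F → Prop
  | skip, _ => True
  | setNat _ _ x, s => (x.eval s).size ≤ B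
  | setField _ _ x, s => x.Safe B s
  | seq c d, s => Safe e B c s ∧ Safe e B d (exec e c s).1
  | ifLe x y c d, s =>
      (x.eval s ≤ y.eval s → Safe e B c s) ∧ (¬ x.eval s ≤ y.eval s → Safe e B d s)
  | ifEq x y c d, s => x.Safe B s ∧ y.Safe B s ∧
      (x.eval e s = y.eval e s → Safe e B c s) ∧ (x.eval e s ≠ y.eval e s → Safe e B d s)
  | loop a b c, s => b.eval s ≤ B ∧
      ∀ j < b.eval s, Safe e B c ((loopState e a c s j).setNat a 0 j)

/-- A coefficient in the bound of the running time of a program. -/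
def weight : Prog → ℕ
  | skip => 1
  | setNat _ i x => 2 * i.weight + 2 * x.weight + 1
  | setField _ i x => 2 * i.weight + x.weight + 1
  | seq c d => c.weight + d.weight
  | ifLe x y c d => 2 * x.weight + 2 * y.weight + 1 + c.weight + d.weight
  | ifEq x y c d => x.weight + y.weight + 1 + c.weight + d.weight
  | loop _ b c => 2 * b.weight + 2 + c.weight

/-- The exponent in the bound of the running time of a program. -/
def degree : Prog → ℕ
  | skip => 1
  | setNat _ _ _ => 1
  | setField _ _ _ => 1
  | seq c d => max c.degree d.degree
  | ifLe _ _ c d => max c.degree d.degree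
  | ifEq _ _ c d => max c.degree d.degree
  | loop _ _ c => c.degree + 1

theorem one_le_degree (c : Prog) : 1 ≤ c.degree := by
  induction c <;> simp_all [degree]

/-- A loop has at most `B` rounds, so it raises the exponent by one; the other constructs only add
coefficients. The bound on stored numbers is carried along because each round starts from the memory
left by the previous one. -/
theorem natBounded_and_time_le (c : Prog) {s : Memory F} (hs : s.NatBounded B)
    (hc : Safe e B c s) : (exec e c s).1.NatBounded B ∧
      (exec e c s).2 ≤ c.weight * (B + 1) ^ c.degree := by
  have hpow : ∀ {i j : ℕ} (w : ℕ), i ≤ j → w * (B + 1) ^ i ≤ w * (B + 1) ^ j := fun w h =>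
    Nat.mul_le_mul_left _ (Nat.pow_le_pow_right (by omega) h)
  induction c generalizing s with
  | skip =>
    refine ⟨hs, ?_⟩
    simp [exec, weight, degree]
  | setNat a i x =>
    have hi := i.size_eval_le_and_cost_le hs
    have hx := x.size_eval_le_and_cost_le hs
    refine ⟨hs.setNat _ _ hc, ?_⟩
    simp only [exec, weight, degree, pow_one]
    rw [add_mul, add_mul, mul_assoc, mul_assoc, one_mul]
    omega
  | setField a i x =>
    have hi := i.size_eval_le_and_cost_le hs
    have hx := x.cost_le hs hc
    refine ⟨hs, ?_⟩
    simp only [exec, weight, degree, pow_one]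
    rw [add_mul, add_mul, mul_assoc, one_mul]
    omega
  | seq c d ihc ihd =>
    have h1 := ihc hs hc.1
    have h2 := ihd h1.1 hc.2
    refine ⟨h2.1, ?_⟩
    simp only [exec, weight, degree]
    rw [add_mul]
    exact add_le_add (h1.2.trans (hpow _ (le_max_left _ _)))
      (h2.2.trans (hpow _ (le_max_right _ _)))
  | ifLe x y c d ihc ihd =>
    have hx := x.size_eval_le_and_cost_le hs
    have hy := y.size_eval_le_and_cost_le hs
    have h1 : 1 ≤ max c.degree d.degree := (one_le_degree c).trans (le_max_left _ _)
    have h2 := hpow (2 * x.weight + 2 * y.weight + 1) h1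
    have h3 := hpow c.weight (le_max_left c.degree d.degree)
    have h4 := hpow d.weight (le_max_right c.degree d.degree)
    simp only [exec, weight, degree]
    rw [add_mul _ d.weight, add_mul _ c.weight]
    rw [pow_one, add_mul, add_mul, mul_assoc, mul_assoc, one_mul] at h2
    split_ifs with h
    · have := ihc hs (hc.1 h)
      exact ⟨this.1, by omega⟩
    · have := ihd hs (hc.2 h)
      exact ⟨this.1, by omega⟩
  | ifEq x y c d ihc ihd =>
    have hx := x.cost_le hs hc.1
    have hy := y.cost_le hs hc.2.1
    have h1 : 1 ≤ max c.degree d.degree := (one_le_degree c).trans (le_max_left _ _)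
    have h2 := hpow (x.weight + y.weight + 1) h1
    have h3 := hpow c.weight (le_max_left c.degree d.degree)
    have h4 := hpow d.weight (le_max_right c.degree d.degree)
    simp only [exec, weight, degree]
    rw [add_mul _ d.weight, add_mul _ c.weight]
    rw [pow_one, add_mul, add_mul, one_mul] at h2
    split_ifs with h
    · have := ihc hs (hc.2.2.1 h)
      exact ⟨this.1, by omega⟩
    · have := ihd hs (hc.2.2.2 h)
      exact ⟨this.1, by omega⟩
  | loop a b c ih =>
    have hb := b.size_eval_le_and_cost_le hs
    obtain ⟨hbB, hc⟩ := hc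
    have hB : B + 1 ≤ (B + 1) ^ c.degree :=
      Nat.le_self_pow (by have := one_le_degree c; omega) _
    have key : ∀ k ≤ b.eval s, (loopState e a c s k).NatBounded B ∧
        loopTime e a c s k ≤ k * ((c.weight + 1) * (B + 1) ^ c.degree) := by
      intro k
      induction k with
      | zero => exact fun _ => ⟨hs, by simp [loopTime]⟩
      | succ k ihk =>
        intro hk
        obtain ⟨h1, h2⟩ := ihk (by omega)
        have hkB : k.size ≤ B := (Nat.size_le_self k).trans (by omega)
        obtain ⟨h3, h4⟩ := ih (h1.setNat a 0 hkB) (hc k (by omega))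
        refine ⟨h3, ?_⟩
        simp only [loopTime]
        have h5 : (c.weight + 1) * (B + 1) ^ c.degree =
            c.weight * (B + 1) ^ c.degree + (B + 1) ^ c.degree := by ring
        rw [add_mul k 1, one_mul]
        omega
    obtain ⟨h1, h2⟩ := key _ le_rfl
    rw [exec_loop]
    refine ⟨h1, ?_⟩
    simp only [weight, degree]
    have h3 : b.eval s * ((c.weight + 1) * (B + 1) ^ c.degree) ≤
        (c.weight + 1) * (B + 1) ^ (c.degree + 1) := by
      calc _ ≤ (B + 1) * ((c.weight + 1) * (B + 1) ^ c.degree) :=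
            Nat.mul_le_mul_right _ (by omega)
        _ = _ := by ring
    have h4 := hpow (2 * b.weight + 1) (show 1 ≤ c.degree + 1 by omega)
    rw [pow_one, add_mul, mul_assoc, one_mul] at h4
    have h5 : (2 * b.weight + 2 + c.weight) * (B + 1) ^ (c.degree + 1) =
        (2 * b.weight + 1) * (B + 1) ^ (c.degree + 1) +
          (c.weight + 1) * (B + 1) ^ (c.degree + 1) := by ring
    omega

/-- The names of the arrays of natural numbers that a program may write. -/
def natWrites : Prog → List ℕ
  | skip => []
  | setNat a _ _ => [a]
  | setField _ _ _ => []
  | seq c d => c.natWrites ++ d.natWrites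
  | ifLe _ _ c d => c.natWrites ++ d.natWrites
  | ifEq _ _ c d => c.natWrites ++ d.natWrites
  | loop a _ c => a :: c.natWrites

/-- The names of the arrays of field elements that a program may write. -/
def fldWrites : Prog → List ℕ
  | skip => []
  | setNat _ _ _ => []
  | setField a _ _ => [a]
  | seq c d => c.fldWrites ++ d.fldWrites
  | ifLe _ _ c d => c.fldWrites ++ d.fldWrites
  | ifEq _ _ c d => c.fldWrites ++ d.fldWrites
  | loop _ _ c => c.fldWrites

/-- The arrays that are not written by `c` agree in `s` and `s'`. -/
def Frame (c : Prog) (s s' : Memory F) : Prop :=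
  (∀ a ∉ c.natWrites, s'.nat a = s.nat a) ∧ ∀ a ∉ c.fldWrites, s'.fld a = s.fld a

theorem frame_refl {F : Type*} (c : Prog) (s : Memory F) : Frame c s s := ⟨fun _ _ => rfl, fun _ _ => rfl⟩

theorem frame_loopState {a : ℕ} {b : NatExpr} {c : Prog} (s : Memory F)
    (h : ∀ s, Frame c s (exec e c s).1) (j : ℕ) :
    Frame (loop a b c) s (loopState e a c s j) := by
  induction j with
  | zero => exact frame_refl _ _
  | succ j ih =>
    refine ⟨fun a' ha' => ?_, fun a' ha' => ?_⟩
    · simp only [natWrites, List.mem_cons, not_or] at ha'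
      rw [loopState, (h _).1 a' ha'.2, ← ih.1 a' (by simp [natWrites, ha'])]
      funext i
      simp [ha'.1]
    · rw [loopState, (h _).2 a' ha', ← ih.2 a' ha']
      rfl

theorem frame_exec (c : Prog) (s : Memory F) : Frame c s (exec e c s).1 := by
  induction c generalizing s with
  | skip => exact frame_refl _ _
  | setNat a i x =>
    refine ⟨fun a' ha' => ?_, fun _ _ => rfl⟩
    funext j
    simp only [natWrites, List.mem_singleton] at ha'
    simp [exec, ha']
  | setField a i x =>
    refine ⟨fun _ _ => rfl, fun a' ha' => ?_⟩
    funext j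
    simp only [fldWrites, List.mem_singleton] at ha'
    simp [exec, ha']
  | seq c d ihc ihd =>
    refine ⟨fun a' ha' => ?_, fun a' ha' => ?_⟩
    · simp only [natWrites, List.mem_append, not_or] at ha'
      exact ((ihd _).1 a' ha'.2).trans ((ihc s).1 a' ha'.1)
    · simp only [fldWrites, List.mem_append, not_or] at ha'
      exact ((ihd _).2 a' ha'.2).trans ((ihc s).2 a' ha'.1)
  | ifLe x y c d ihc ihd =>
    refine ⟨fun a' ha' => ?_, fun a' ha' => ?_⟩
    · simp only [natWrites, List.mem_append, not_or] at ha'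
      simp only [exec]
      split_ifs
      · exact (ihc s).1 a' ha'.1
      · exact (ihd s).1 a' ha'.2
    · simp only [fldWrites, List.mem_append, not_or] at ha'
      simp only [exec]
      split_ifs
      · exact (ihc s).2 a' ha'.1
      · exact (ihd s).2 a' ha'.2
  | ifEq x y c d ihc ihd =>
    refine ⟨fun a' ha' => ?_, fun a' ha' => ?_⟩
    · simp only [natWrites, List.mem_append, not_or] at ha'
      simp only [exec]
      split_ifs
      · exact (ihc s).1 a' ha'.1
      · exact (ihd s).1 a' ha'.2
    · simp only [fldWrites, List.mem_append, not_or] at ha'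
      simp only [exec]
      split_ifs
      · exact (ihc s).2 a' ha'.1
      · exact (ihd s).2 a' ha'.2
  | loop a b c ih =>
    rw [exec_loop]
    exact frame_loopState s ih _

/-- The program `c`, started from `s`, runs safely and ends in a memory that satisfies `Q`. -/
def Ok (e : ℕ → F) (B : ℕ) (c : Prog) (s : Memory F) (Q : Memory F → Prop) : Prop :=
  Safe e B c s ∧ Q (exec e c s).1

namespace Ok

variable {c d : Prog} {s : Memory F} {Q Q' : Memory F → Prop}

/-- The frame condition is handed to the continuation, so postconditions need not mention the arrays
a subprogram leaves alone. -/
theorem mono (h : Ok e B c s Q) (hQ : ∀ s', Frame c s s' → Q s' → Q' s') : Ok e B c s Q' :=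
  ⟨h.1, hQ _ (frame_exec c s) h.2⟩

theorem skip (h : Q s) : Ok e B .skip s Q := ⟨trivial, h⟩

theorem seq (h : Ok e B c s fun s' => Ok e B d s' Q) : Ok e B (.seq c d) s Q :=
  ⟨⟨h.1, h.2.1⟩, h.2.2⟩

theorem setNat {a : ℕ} {i x : NatExpr} (hx : (x.eval s).size ≤ B)
    (h : Q (s.setNat a (i.eval s) (x.eval s))) : Ok e B (.setNat a i x) s Q := ⟨hx, h⟩

theorem setField {a : ℕ} {i : NatExpr} {x : FieldExpr} (hx : x.Safe B s)
    (h : Q (s.setFld a (i.eval s) (x.eval e s))) : Ok e B (.setField a i x) s Q := ⟨hx, h⟩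

theorem ifLe {x y : NatExpr} (h1 : x.eval s ≤ y.eval s → Ok e B c s Q)
    (h2 : ¬ x.eval s ≤ y.eval s → Ok e B d s Q) : Ok e B (.ifLe x y c d) s Q := by
  refine ⟨⟨fun h => (h1 h).1, fun h => (h2 h).1⟩, ?_⟩
  simp only [exec]
  split_ifs with h
  · exact (h1 h).2
  · exact (h2 h).2

theorem ifEq {x y : FieldExpr} (hx : x.Safe B s) (hy : y.Safe B s)
    (h1 : x.eval e s = y.eval e s → Ok e B c s Q)
    (h2 : x.eval e s ≠ y.eval e s → Ok e B d s Q) : Ok e B (.ifEq x y c d) s Q := by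
  refine ⟨⟨hx, hy, fun h => (h1 h).1, fun h => (h2 h).1⟩, ?_⟩
  simp only [exec]
  split_ifs with h
  · exact (h1 h).2
  · exact (h2 h).2

/-- The usual invariant rule, except that the body may also use the frame of the whole loop relative
to the initial memory. -/
theorem loop {a : ℕ} {b : NatExpr} (I : ℕ → Memory F → Prop) {l : ℕ} (hl : b.eval s = l)
    (hB : l ≤ B) (h0 : I 0 s)
    (hstep : ∀ j < l, ∀ s', Frame (.loop a b c) s s' → I j s' →
      Ok e B c (s'.setNat a 0 j) (I (j + 1)))
    (hQ : ∀ s', Frame (.loop a b c) s s' → I l s' → Q s') : Ok e B (.loop a b c) s Q := by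
  subst hl
  have key : ∀ j ≤ b.eval s, I j (loopState e a c s j) := by
    intro j
    induction j with
    | zero => exact fun _ => h0
    | succ j ih =>
      exact fun hj => (hstep j hj _ (frame_loopState s (frame_exec c) j) (ih (by omega))).2
  refine ⟨⟨hB, fun j hj => ?_⟩, ?_⟩
  · exact (hstep j hj _ (frame_loopState s (frame_exec c) j) (key j hj.le)).1
  · rw [exec_loop]
    exact hQ _ (frame_loopState s (frame_exec c) _) (key _ le_rfl)

/-- A loop that fills the first entries of the field array `A`. -/
theorem fill {a A : ℕ} {b : NatExpr} (Φ : ℕ → F) {l : ℕ} (hl : b.eval s = l) (hB : l ≤ B)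
    (hstep : ∀ j < l, ∀ s', Frame (.loop a b c) s s' →
      Ok e B c (s'.setNat a 0 j) fun s'' => s''.fld A j = Φ j ∧
        ∀ i, i ≠ j → s''.fld A i = s'.fld A i)
    (hQ : ∀ s', Frame (.loop a b c) s s' → (∀ i < l, s'.fld A i = Φ i) → Q s') :
    Ok e B (.loop a b c) s Q := by
  refine loop (fun j s' => ∀ i < j, s'.fld A i = Φ i) hl hB (fun i hi => by omega)
    (fun j hj s' hs' hI => (hstep j hj s' hs').mono fun s'' _ h i hi => ?_) hQ
  by_cases hij : i = j
  · subst hij; exact h.1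
  · rw [h.2 i hij]
    exact hI i (by omega)

end Ok

end Prog

/-! ### The program that lists the hitting set. -/

section Programs

/-- The scalar stored at index `0` of an array of natural numbers. -/
def NatExpr.var (a : ℕ) : NatExpr := .get a (.const 0)

/-- The scalar stored at index `0` of an array of field elements. -/
def FieldExpr.var (a : ℕ) : FieldExpr := .get a (.const 0)

/-- Entry `i` of the array of the input. -/
def NatExpr.inp (i : ℕ) : NatExpr := .get 0 (.const i)

/-- Entry `i` of the array of derived parameters. -/
def NatExpr.par (i : ℕ) : NatExpr := .get 1 (.const i)

namespace Prog

open NatExpr (inp par)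

/-- Computes the parameters `N, K, R, m` from the input. -/
def setupProg : Prog :=
  .seq (.setNat 1 (.const 2) (.mul (inp 2) (.add (inp 0) (.const 1))))
  (.seq (.setNat 1 (.const 3) (.mul (inp 1) (.mul (par 2) (par 2))))
  (.seq (.setNat 1 (.const 0) (.mul (.mul (.const 2) (.add (inp 0) (.const 1))) (par 3)))
  (.seq (.setNat 1 (.const 1) (.mul (.mul (.mul (.const 2) (.add (inp 0) (.const 1))) (inp 1))
    (.mul (par 3) (par 2))))
  (.seq (.setNat 3 (.const 0) (.const 1))
  (.setNat 4 (.const 0) (inp 3))))))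

/-- Finds a field element none of whose first `N - 1` powers is `0` or `1`. -/
def orderProg : Prog :=
  .loop 5 (.mul (par 0) (par 0))
    (.seq (.setNat 2 (.const 0) (.const 1))
    (.seq (.setField 6 (.const 0) (.enum (.var 5)))
    (.seq (.ifEq (.var 6) .zero (.setNat 2 (.const 0) (.const 0)) .skip)
    (.seq (.setField 7 (.const 0) .one)
    (.seq
      (.loop 6 (.sub (par 0) (.const 1))
        (.seq (.setField 7 (.const 0) (.mul (.var 7) (.var 6)))
        (.ifEq (.var 7) .one (.setNat 2 (.const 0) (.const 0)) .skip)))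
      (.ifLe (.const 1) (.var 2) (.setField 5 (.const 0) (.var 6)) .skip))))))

/-- Tabulates the first `m` powers of the element found. -/
def powersProg : Prog :=
  .seq (.setField 7 (.const 0) .one)
  (.loop 5 (par 3)
    (.seq (.setField 2 (.var 5) (.var 7))
    (.setField 7 (.const 0) (.mul (.var 7) (.var 5)))))

/-- Reads the next seed. -/
def seedProg : Prog :=
  .seq (.setField 6 (.const 0) (.enum (.mod (.var 4) (par 1))))
  (.setNat 4 (.const 0) (.div (.var 4) (par 1)))

/-- Tabulates the values of the Lagrange basis at the geometric progression from the seed. -/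
def tableProg : Prog :=
  .loop 5 (.mul (par 2) (par 3))
    (.seq (.setField 7 (.const 0) .one)
    (.seq
      (.loop 6 (par 3)
        (.ifEq (.get 2 (.mod (.var 5) (par 3))) (.get 2 (.var 6)) .skip
          (.setField 7 (.const 0) (.mul (.var 7) (.mul
            (.sub (.mul (.get 2 (.div (.var 5) (par 3))) (.var 6)) (.get 2 (.var 6)))
            (.inv (.sub (.get 2 (.mod (.var 5) (par 3))) (.get 2 (.var 6)))))))))
      (.setField 3 (.var 5) (.var 7))))

/-- The curves of height `0`. -/
def leafProg : Prog :=
  .loop 5 (.mul (.mul (inp 0) (par 2)) (inp 1))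
    (.setField 1 (.var 5) (.get 3
      (.add (.mul (.mod (.div (.var 5) (inp 1)) (par 2)) (par 3)) (.mod (.var 5) (inp 1)))))

/-- The bit of the leaf that decides between the two halves of its block. -/
def bitExpr : NatExpr :=
  .mod (.div (.div (.var 5) (.mul (inp 1) (par 2))) (.var 3)) (.const 2)

/-- The index of the point to be used for the leaf. -/
def halfExpr : NatExpr :=
  .add (.mul bitExpr (.div (.var 6) (par 2)))
    (.mul (.sub (.const 1) bitExpr) (.mod (.var 6) (par 2)))

/-- Passes from the curves of one height to those of the next. -/
def mergeProg : Prog :=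
  .seq
    (.loop 5 (.mul (.mul (inp 0) (par 2)) (inp 1))
      (.seq (.setField 7 (.const 0) .zero)
      (.seq
        (.loop 6 (.mul (par 2) (par 2))
          (.setField 7 (.const 0) (.add (.var 7) (.mul
            (.get 3 (.add (.mul (.mod (.div (.var 5) (inp 1)) (par 2)) (par 3)) (.var 6)))
            (.get 1 (.add (.mul (.add (.mul (.div (.var 5) (.mul (inp 1) (par 2))) (par 2))
              halfExpr) (inp 1)) (.mod (.var 5) (inp 1))))))))
        (.setField 4 (.var 5) (.var 7)))))
  (.seq
    (.loop 5 (.mul (.mul (inp 0) (par 2)) (inp 1)) (.setField 1 (.var 5) (.get 4 (.var 5))))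
    (.setNat 3 (.const 0) (.mul (.const 2) (.var 3))))

/-- Passes from height `0` to the least height `L` with `D ≤ 2 ^ L`. -/
def levelsProg : Prog :=
  .loop 7 (inp 0)
    (.ifLe (inp 0) (.var 3) .skip (.seq seedProg (.seq tableProg mergeProg)))

/-- Writes the matrices. -/
def outputProg : Prog :=
  .loop 5 (.mul (inp 1) (.mul (.add (inp 0) (.const 1)) (.add (inp 0) (.const 1))))
    (.seq (.setField 0 (.var 5) .zero)
    (.ifLe
      (.add (.mod (.div (.var 5) (.add (inp 0) (.const 1))) (.add (inp 0) (.const 1))) (.const 1))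
      (.mod (.var 5) (.add (inp 0) (.const 1)))
      (.ifLe (.mod (.var 5) (.add (inp 0) (.const 1)))
        (.add (.mod (.div (.var 5) (.add (inp 0) (.const 1))) (.add (inp 0) (.const 1)))
          (.const 1))
        (.setField 0 (.var 5) (.get 1 (.add
          (.mul (.mul (.mod (.div (.var 5) (.add (inp 0) (.const 1))) (.add (inp 0) (.const 1)))
            (par 2)) (inp 1))
          (.div (.var 5) (.mul (.add (inp 0) (.const 1)) (.add (inp 0) (.const 1)))))))
        .skip)
      .skip))

/-- The program that computes the hitting set. -/
def hittingProg : Prog :=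
  .seq setupProg (.seq orderProg (.seq powersProg (.seq seedProg (.seq tableProg
    (.seq leafProg (.seq levelsProg outputProg))))))

end Prog

end Programs

/-! ### Correctness and safety of the program. -/

/-- The parameters stored in the memory. -/
structure Memory.Params {F : Type*} (D n N K R m : ℕ) (s : Memory F) : Prop where
  depth : s.nat 0 0 = D
  vars : s.nat 0 1 = n
  order : s.nat 1 0 = N
  seeds : s.nat 1 1 = K
  rank : s.nat 1 2 = R
  nodes : s.nat 1 3 = m

theorem Memory.Params.congr {F : Type*} {D n N K R m : ℕ} {s s' : Memory F}
    (h : s.Params D n N K R m) (h0 : s'.nat 0 = s.nat 0) (h1 : s'.nat 1 = s.nat 1) :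
    s'.Params D n N K R m := by
  obtain ⟨a, b, c, d, e, f⟩ := h
  exact ⟨by rw [h0, a], by rw [h0, b], by rw [h1, c], by rw [h1, d], by rw [h1, e], by rw [h1, f]⟩

namespace Prog

variable {F : Type*} [Field F] {e : ℕ → F} {B D n N K R m : ℕ} {s : Memory F}

/-- `x` is nonzero and none of its powers up to exponent `i` is `1`. -/
def NoSmallOrder (x : F) (i : ℕ) : Prop := x ≠ 0 ∧ ∀ l, 1 ≤ l → l ≤ i → x ^ l ≠ 1

theorem noSmallOrder_succ {x : F} {i : ℕ} :
    NoSmallOrder x (i + 1) ↔ NoSmallOrder x i ∧ x ^ (i + 1) ≠ 1 := by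
  refine ⟨fun h => ⟨⟨h.1, fun l h1 h2 => h.2 l h1 (by omega)⟩, h.2 _ (by omega) le_rfl⟩,
    fun h => ⟨h.1.1, fun l h1 h2 => ?_⟩⟩
  rcases Nat.lt_or_ge i l with h3 | h3
  · obtain rfl : l = i + 1 := by omega
    exact h.2
  · exact h.1.2 l h1 h3

open Classical in
/-- The last of the first `j` listed elements that has no small order, or `0`. -/
noncomputable def lastNoSmallOrder (e : ℕ → F) (N : ℕ) : ℕ → F
  | 0 => 0
  | j + 1 => if NoSmallOrder (e j) (N - 1) then e j else lastNoSmallOrder e N j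

theorem noSmallOrder_last {j : ℕ} (h : ∃ c < j, NoSmallOrder (e c) (N - 1)) :
    NoSmallOrder (lastNoSmallOrder e N j) (N - 1) := by
  induction j with
  | zero => obtain ⟨c, hc, -⟩ := h; omega
  | succ j ih =>
    rw [lastNoSmallOrder]
    split_ifs with hj
    · exact hj
    · obtain ⟨c, hc, hgood⟩ := h
      refine ih ⟨c, ?_, hgood⟩
      rcases Nat.lt_or_ge c j with hcj | hcj
      · exact hcj
      · obtain rfl : c = j := by omega
        exact absurd hgood hj

/-- A loop cannot be left early, so later successful candidates overwrite earlier ones and the last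
one survives. Entry `0` of the number array `2` is the flag saying whether the current candidate has
passed so far. -/
theorem ok_orderProg (hP : s.Params D n N K R m) (hB : N * N ≤ B) (hN : N ≤ B) (hB1 : 1 ≤ B)
    (h0 : s.fld 5 0 = 0) :
    Ok e B orderProg s fun s' => s'.fld 5 0 = lastNoSmallOrder e N (N * N) := by
  unfold orderProg
  refine Ok.loop (fun j s' => s'.fld 5 0 = lastNoSmallOrder e N j) (l := N * N)
    (by simp [NatExpr.eval, NatExpr.par, hP.order]) hB h0 (fun j hj s₁ hs₁ hI => ?_)
    (fun s' _ h => h)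
  have hP₁ : s₁.Params D n N K R m :=
    hP.congr (hs₁.1 0 (by simp [natWrites])) (hs₁.1 1 (by simp [natWrites]))
  refine .seq (.setNat (by simpa [NatExpr.eval] using hB1) ?_)
  refine .seq (.setField (by simp [FieldExpr.Safe, NatExpr.eval, NatExpr.var]; omega) ?_)
  simp only [NatExpr.eval, NatExpr.var, FieldExpr.eval]
  set x := e j with hx
  refine .seq (Ok.mono (Q := fun s' => s'.fld 5 = s₁.fld 5 ∧ s'.fld 6 0 = x ∧
    (s'.nat 2 0 = 1 ∧ x ≠ 0 ∨ s'.nat 2 0 = 0 ∧ ¬ x ≠ 0)) (Ok.ifEq (by simp [FieldExpr.Safe,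
      FieldExpr.var]) trivial (fun h => .setNat (by simp [NatExpr.eval]) ?_) (fun h => .skip ?_))
    fun s₂ hs₂ ⟨h5, h6, h2⟩ => ?_)
  · have h : x = 0 := by simpa [FieldExpr.eval, FieldExpr.var, NatExpr.eval, ← hx] using h
    refine ⟨?_, ?_, Or.inr ⟨?_, by simp [h]⟩⟩
    · funext i; simp
    · simp [← hx]
    · simp [NatExpr.eval]
  · have h : x ≠ 0 := by simpa [FieldExpr.eval, FieldExpr.var, NatExpr.eval, ← hx] using h
    refine ⟨?_, ?_, Or.inl ⟨?_, h⟩⟩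
    · funext i; simp
    · simp [← hx]
    · simp
  have hP₂ : s₂.Params D n N K R m :=
    hP₁.congr ((hs₂.1 0 (by simp [natWrites])).trans (by funext i; simp))
      ((hs₂.1 1 (by simp [natWrites])).trans (by funext i; simp))
  refine .seq (.setField trivial (.seq (.loop (fun i s' => s'.fld 5 = s₁.fld 5 ∧ s'.fld 6 0 = x ∧
    s'.fld 7 0 = x ^ i ∧ (s'.nat 2 0 = 1 ∧ NoSmallOrder x i ∨
      s'.nat 2 0 = 0 ∧ ¬ NoSmallOrder x i)) (l := N - 1)
    (by simp [NatExpr.eval, NatExpr.par, hP₂.order]) (by omega) ?_ (fun i hi s₃ _ ⟨g5, g6, g7, g2⟩ =>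
      .seq (.setField ?_ (.ifEq ?_ trivial (fun h => .setNat ?_ ?_) (fun h => .skip ?_))))
    (fun s₃ _ ⟨g5, g6, g7, g2⟩ => .ifLe (fun h => .setField ?_ ?_) (fun h => .skip ?_)))))
  · refine ⟨?_, ?_, ?_, ?_⟩
    · funext i; simp [h5]
    · simp [h6]
    · simp [FieldExpr.eval, NatExpr.eval]
    · have : NoSmallOrder x 0 ↔ x ≠ 0 :=
        ⟨fun h => h.1, fun h => ⟨h, fun l h1 h2 => by omega⟩⟩
      simpa [this] using h2
  · simp [FieldExpr.Safe, FieldExpr.var]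
  · simp [FieldExpr.Safe, FieldExpr.var]
  · simp [NatExpr.eval]
  · have h : x ^ (i + 1) = 1 := by
      simpa [FieldExpr.eval, FieldExpr.var, NatExpr.eval, g6, g7, pow_succ] using h
    refine ⟨?_, ?_, ?_, Or.inr ⟨?_, ?_⟩⟩
    · funext l; simp [g5]
    · simp [g6]
    · simp [FieldExpr.eval, FieldExpr.var, NatExpr.eval, g6, g7, pow_succ]
    · simp [NatExpr.eval]
    · simp [noSmallOrder_succ, h]
  · have h : x ^ (i + 1) ≠ 1 := by
      simpa [FieldExpr.eval, FieldExpr.var, NatExpr.eval, g6, g7, pow_succ] using h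
    refine ⟨?_, ?_, ?_, ?_⟩
    · funext l; simp [g5]
    · simp [g6]
    · simp [FieldExpr.eval, FieldExpr.var, NatExpr.eval, g6, g7, pow_succ]
    · simpa [noSmallOrder_succ, h] using g2
  · simp [FieldExpr.Safe, FieldExpr.var]
  · have h : 1 ≤ s₃.nat 2 0 := by simpa [NatExpr.eval, NatExpr.var] using h
    have : NoSmallOrder x (N - 1) := by
      rcases g2 with ⟨_, g2⟩ | ⟨g2, _⟩
      · exact g2
      · omega
    simp [FieldExpr.eval, FieldExpr.var, NatExpr.eval, g6, lastNoSmallOrder, ← hx, this]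
  · have h : ¬ 1 ≤ s₃.nat 2 0 := by simpa [NatExpr.eval, NatExpr.var] using h
    have : ¬ NoSmallOrder x (N - 1) := by
      rcases g2 with ⟨g2, _⟩ | ⟨_, g2⟩
      · omega
      · exact g2
    rw [g5, hI, lastNoSmallOrder, if_neg this]

theorem ok_powersProg {ω : F} (hP : s.Params D n N K R m) (hB : m ≤ B) (hω : s.fld 5 0 = ω) :
    Ok e B powersProg s fun s' => ∀ q < m, s'.fld 2 q = ω ^ q := by
  unfold powersProg
  refine .seq (.setField trivial (.loop (fun j s' => s'.fld 7 0 = ω ^ j ∧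
    ∀ q < j, s'.fld 2 q = ω ^ q) (l := m) ?_ hB ⟨?_, fun q hq => by omega⟩
    (fun j hj s₁ hs₁ ⟨h7, h2⟩ => .seq (.setField ?_ (.setField ?_ ⟨?_, fun q hq => ?_⟩)))
    fun s' _ h => h.2))
  · simp [NatExpr.eval, NatExpr.par, hP.nodes]
  · simp [FieldExpr.eval, NatExpr.eval]
  · simp [FieldExpr.Safe, FieldExpr.var]
  · simp [FieldExpr.Safe, FieldExpr.var]
  · have h5 : s₁.fld 5 0 = ω := by
      rw [hs₁.2 5 (by simp [fldWrites])]
      simpa using hω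
    simp [FieldExpr.eval, FieldExpr.var, NatExpr.eval, h7, h5, pow_succ]
  · by_cases hqj : q = j
    · simp [FieldExpr.eval, FieldExpr.var, NatExpr.eval, NatExpr.var, h7, hqj]
    · simp [NatExpr.eval, NatExpr.var, hqj, h2 q (by omega)]

/-- The array `4` holds the base-`K` digits of the index not yet consumed; reading a seed removes
the lowest one. -/
theorem ok_seedProg {k : ℕ} (hP : s.Params D n N K R m) (hB : K ≤ B) (hK : 0 < K)
    (hk : s.nat 4 0 = k) (hkB : k.size ≤ B) :
    Ok e B seedProg s fun s' => s'.fld 6 0 = e (k % K) ∧ s'.nat 4 0 = k / K := by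
  unfold seedProg
  refine .seq (.setField ?_ (.setNat ?_ ⟨?_, ?_⟩))
  · have := Nat.mod_lt k hK
    simp [FieldExpr.Safe, NatExpr.eval, NatExpr.var, NatExpr.par, hP.seeds, hk]
    omega
  · simp only [NatExpr.eval, NatExpr.var, NatExpr.par, hP.seeds, hk, Memory.setFld_nat]
    exact (Nat.size_le_size (Nat.div_le_self k K)).trans hkB
  · simp [FieldExpr.eval, NatExpr.eval, NatExpr.var, NatExpr.par, hP.seeds, hk]
  · simp [NatExpr.eval, NatExpr.var, NatExpr.par, hP.seeds, hk]

theorem ok_tableProg {ω α : F} (hP : s.Params D n N K R m) (hB : R * m ≤ B) (hmB : m ≤ B)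
    (hRm : R ≤ m) (h2 : ∀ q < m, s.fld 2 q = ω ^ q) (h6 : s.fld 6 0 = α) :
    Ok e B tableProg s fun s' => ∀ i < R * m,
      s'.fld 3 i = geomBasis ω m (i % m) (ω ^ (i / m) * α) := by
  classical
  unfold tableProg
  refine .fill (fun i => geomBasis ω m (i % m) (ω ^ (i / m) * α)) (l := R * m)
    (by simp [NatExpr.eval, NatExpr.par, hP.rank, hP.nodes]) hB (fun j hj s₁ hs₁ => ?_)
    (fun s' _ h => h)
  have hP₁ : s₁.Params D n N K R m :=
    hP.congr (hs₁.1 0 (by simp [natWrites])) (hs₁.1 1 (by simp [natWrites]))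
  have hm0 : 0 < m := Nat.pos_of_ne_zero fun h => by simp [h] at hj
  have hjm : j % m < m := Nat.mod_lt _ hm0
  have hjd : j / m < m := (Nat.div_lt_of_lt_mul (by rwa [mul_comm] at hj)).trans_le hRm
  have f2 : ∀ q < m, s₁.fld 2 q = ω ^ q := fun q hq => by
    rw [hs₁.2 2 (by simp [fldWrites]), h2 q hq]
  have f6 : s₁.fld 6 0 = α := by rw [hs₁.2 6 (by simp [fldWrites]), h6]
  -- The invariant is a partial product of `geomBasis`. Its case distinction compares nodes rather
  -- than indices, matching the field equality test in the program.
  refine .seq (.setField trivial (.seq (.loop (fun i s' => s'.fld 7 0 =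
    ∏ q' ∈ Finset.range i, if ω ^ (j % m) = ω ^ q' then 1 else
      (ω ^ (j / m) * α - ω ^ q') * (ω ^ (j % m) - ω ^ q')⁻¹) (l := m)
      ?_ hmB ?_ (fun i hi s₂ hs₂ h7 => ?_)
      (fun s₂ hs₂ h7 => .setField ?_ ⟨?_, fun i hi => ?_⟩))))
  · simp [NatExpr.eval, NatExpr.par, hP₁.nodes]
  · simp [FieldExpr.eval, NatExpr.eval]
  · have e1 : s₂.nat 1 3 = m := by
      rw [hs₂.1 1 (by simp [natWrites])]
      simp [hP₁.nodes]
    have e5 : s₂.nat 5 0 = j := by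
      rw [hs₂.1 5 (by simp [natWrites])]
      simp
    have e2 : ∀ q < m, s₂.fld 2 q = ω ^ q := fun q hq => by
      rw [hs₂.2 2 (by simp [fldWrites])]
      simp [f2 q hq]
    have e6 : s₂.fld 6 0 = α := by
      rw [hs₂.2 6 (by simp [fldWrites])]
      simp [f6]
    refine .ifEq trivial trivial (fun h => .skip ?_) (fun h => .setField ?_ ?_)
    · simp only [FieldExpr.eval, NatExpr.eval, NatExpr.var, NatExpr.par, Memory.setNat_nat,
        Memory.setNat_fld] at h
      simp [e1, e5, e2 _ hjm, e2 _ hi] at h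
      simp [Finset.prod_range_succ, h7, h]
    · simp [FieldExpr.Safe, FieldExpr.var]
    · simp only [FieldExpr.eval, NatExpr.eval, NatExpr.var, NatExpr.par, Memory.setNat_nat,
        Memory.setNat_fld] at h
      simp [e1, e5, e2 _ hjm, e2 _ hi] at h
      simp [Finset.prod_range_succ, h7, h, FieldExpr.eval, FieldExpr.var, NatExpr.eval,
        NatExpr.var, NatExpr.par, e1, e5, e6, e2 _ hjm, e2 _ hjd, e2 _ hi]
  · simp [FieldExpr.Safe, FieldExpr.var]
  · have e5 : s₂.nat 5 0 = j := by
      rw [hs₂.1 5 (by simp [natWrites])]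
      simp
    simp [FieldExpr.eval, FieldExpr.var, NatExpr.eval, NatExpr.var, e5, h7, geomBasis]
  · have e5 : s₂.nat 5 0 = j := by
      rw [hs₂.1 5 (by simp [natWrites])]
      simp
    have e3 : s₂.fld 3 i = s₁.fld 3 i := by
      rw [hs₂.2 3 (by simp [fldWrites])]
      simp
    simp [NatExpr.eval, NatExpr.var, e5, hi, e3]

/-- The values of the curves of height `h` at the geometric progression from the seed `α h`. -/
def HoldsCurves (ω : F) (D n R m : ℕ) (α : ℕ → F) (h : ℕ) (s : Memory F) : Prop :=
  ∀ i < D * R * n, s.fld 1 i =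
    leafCurve ω m R α h (i / (n * R)) (ω ^ (i / n % R) * α h) (i % n)

theorem mul_add_lt {a b c R : ℕ} (ha : a < R) (hb : b < c) : a * c + b < R * c :=
  calc a * c + b < a * c + c := by omega
    _ = (a + 1) * c := by ring
    _ ≤ R * c := Nat.mul_le_mul_right _ ha

theorem mul_add_div_self {a b c : ℕ} (hb : b < c) : (a * c + b) / c = a := by
  rw [Nat.add_comm, Nat.add_mul_div_right _ _ (by omega), Nat.div_eq_of_lt hb, zero_add]

theorem mul_add_mod_self {a b c : ℕ} (hb : b < c) : (a * c + b) % c = b := by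
  rw [Nat.mul_add_mod', Nat.mod_eq_of_lt hb]

theorem ok_leafProg {ω : F} {α : ℕ → F} (hP : s.Params D n N K R m) (hB : D * R * n ≤ B)
    (hnm : n ≤ m)
    (h3 : ∀ i < R * m, s.fld 3 i = geomBasis ω m (i % m) (ω ^ (i / m) * α 0)) :
    Ok e B leafProg s (HoldsCurves ω D n R m α 0) := by
  unfold leafProg
  refine .fill (fun i => leafCurve ω m R α 0 (i / (n * R)) (ω ^ (i / n % R) * α 0) (i % n))
    (l := D * R * n) (by simp [NatExpr.eval, NatExpr.par, NatExpr.inp, hP.depth, hP.vars, hP.rank])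
    hB (fun j hj s₁ hs₁ => .setField trivial ⟨?_, fun i hi => ?_⟩) (fun s' _ h => h)
  · have hP₁ : s₁.Params D n N K R m :=
      hP.congr (hs₁.1 0 (by simp [natWrites])) (hs₁.1 1 (by simp [natWrites]))
    have hn0 : 0 < n := Nat.pos_of_ne_zero fun h => by simp [h] at hj
    have hR0 : 0 < R := Nat.pos_of_ne_zero fun h => by simp [h] at hj
    have f3 : s₁.fld 3 = s.fld 3 := hs₁.2 3 (by simp [fldWrites])
    have hjn : j % n < m := (Nat.mod_lt _ hn0).trans_le hnm
    have hjR : j / n % R < R := Nat.mod_lt _ hR0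
    simp [FieldExpr.eval, NatExpr.eval, NatExpr.var, NatExpr.par, NatExpr.inp, hP₁.vars, hP₁.rank,
      hP₁.nodes, f3, h3 _ (mul_add_lt hjR hjn), mul_add_div_self hjn, mul_add_mod_self hjn,
      leafCurve]
  · simp [NatExpr.eval, NatExpr.var, hi]

/-- A new entry depends on several points of the old curve of the same leaf, so the new values are
collected in the field array `4` and copied back only when all are complete. The assumption `2 ^ h <
D` bounds the doubled power by `2 * D`. -/
theorem ok_mergeProg {ω : F} {α : ℕ → F} {h : ℕ} (hP : s.Params D n N K R m)
    (hB : D * R * n ≤ B) (hRB : R * R ≤ B) (hDB : 2 * D ≤ B) (hRm : R * R ≤ m) (hn0 : 0 < n)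
    (hR0 : 0 < R) (hpw : s.nat 3 0 = 2 ^ h) (hlt : 2 ^ h < D)
    (h3 : ∀ i < R * m, s.fld 3 i = geomBasis ω m (i % m) (ω ^ (i / m) * α (h + 1)))
    (h1 : HoldsCurves ω D n R m α h s) :
    Ok e B mergeProg s fun s' => s'.nat 3 0 = 2 ^ (h + 1) ∧
      HoldsCurves ω D n R m α (h + 1) s' := by
  set Φ : ℕ → F := fun i =>
    leafCurve ω m R α (h + 1) (i / (n * R)) (ω ^ (i / n % R) * α (h + 1)) (i % n) with hΦ
  unfold mergeProg
  refine .seq (.fill (A := 4) Φ (l := D * R * n)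
    (by simp [NatExpr.eval, NatExpr.par, NatExpr.inp, hP.depth, hP.vars, hP.rank])
    hB (fun j hj s₁ hs₁ => ?_) (fun s₁ hs₁ f4 => .seq (.fill (A := 1) Φ (l := D * R * n) ?_ hB
      (fun j hj s₂ hs₂ => .setField trivial ⟨?_, fun i hi => ?_⟩) (fun s₂ hs₂ f1 =>
        .setNat ?_ ⟨?_, f1⟩))))
  · have hP₁ : s₁.Params D n N K R m :=
      hP.congr (hs₁.1 0 (by simp [natWrites])) (hs₁.1 1 (by simp [natWrites]))
    have f3 : s₁.fld 3 = s.fld 3 := hs₁.2 3 (by simp [fldWrites])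
    have f1 : s₁.fld 1 = s.fld 1 := hs₁.2 1 (by simp [fldWrites])
    have f33 : s₁.nat 3 0 = 2 ^ h := by rw [hs₁.1 3 (by simp [natWrites]), hpw]
    have hjR : j / n % R < R := Nat.mod_lt _ hR0
    have hjn : j % n < n := Nat.mod_lt _ hn0
    have hjD : j / (n * R) < D := Nat.div_lt_of_lt_mul (by
      calc j < D * R * n := hj
        _ = n * R * D := by ring)
    set x := ω ^ (j / n % R) * α (h + 1) with hx
    set J := j / (n * R) with hJ
    refine .seq (.setField trivial (.seq (.loop (fun q s' => s'.fld 7 0 =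
      ∑ q' ∈ Finset.range q, geomBasis ω m q' x * leafCurve ω m R α h (J)
        (ω ^ halfIndex R h (J) q' * α h) (j % n)) (l := R * R) ?_ hRB ?_
      (fun q hq s₂ hs₂ h7 => .setField ?_ ?_)
      (fun s₂ hs₂ h7 => .setField ?_ ⟨?_, fun i hi => ?_⟩))))
    · simp [NatExpr.eval, NatExpr.par, hP₁.rank]
    · simp [FieldExpr.eval, NatExpr.eval]
    · simp [FieldExpr.Safe, FieldExpr.var]
    · have hP₂ : s₂.Params D n N K R m :=
        hP₁.congr ((hs₂.1 0 (by simp [natWrites])).trans (by funext i; simp))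
          ((hs₂.1 1 (by simp [natWrites])).trans (by funext i; simp))
      have e5 : s₂.nat 5 0 = j := by
        rw [hs₂.1 5 (by simp [natWrites])]
        simp
      have e33 : s₂.nat 3 0 = 2 ^ h := by
        rw [hs₂.1 3 (by simp [natWrites])]
        simp [f33]
      have e3 : ∀ i, s₂.fld 3 i = s.fld 3 i := fun i => by
        rw [hs₂.2 3 (by simp [fldWrites])]
        simp [f3]
      have e1 : ∀ i, s₂.fld 1 i = s.fld 1 i := fun i => by
        rw [hs₂.2 1 (by simp [fldWrites])]
        simp [f1]
      have hqm : q < m := hq.trans_le hRm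
      -- Either half of the index is below `R`, so the table of the lower height, with `R` points
      -- per leaf, contains the required value.
      have hhalf : halfIndex R h (J) q < R := by
        have hb : J / 2 ^ h % 2 = 0 ∨ J / 2 ^ h % 2 = 1 := by omega
        have h4 : q / R < R := Nat.div_lt_of_lt_mul hq
        have h5 : q % R < R := Nat.mod_lt _ hR0
        rcases hb with hb | hb <;> simp [halfIndex, hb, h4, h5]
      have hidx1 := mul_add_lt hjD hhalf
      have hidx := mul_add_lt hidx1 hjn
      have hd1 : ((J * R + halfIndex R h (J) q) * n + j % n) / n =
          J * R + halfIndex R h (J) q := mul_add_div_self hjn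
      have key := h1 _ hidx
      rw [← Nat.div_div_eq_div_mul, hd1, mul_add_div_self hhalf, mul_add_mod_self hhalf,
        mul_add_mod_self hjn] at key
      have key3 := h3 _ (mul_add_lt hjR hqm)
      rw [mul_add_div_self hqm, mul_add_mod_self hqm, ← hx] at key3
      rw [Finset.sum_range_succ, ← h7, ← key, ← key3]
      simp [FieldExpr.eval, FieldExpr.var, NatExpr.eval, NatExpr.var, NatExpr.par, NatExpr.inp,
        halfExpr, bitExpr, hP₂.vars, hP₂.rank, hP₂.nodes, e5, e33, e3, e1, halfIndex, hJ]
    · simp [FieldExpr.Safe, FieldExpr.var]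
    · have e5 : s₂.nat 5 0 = j := by
        rw [hs₂.1 5 (by simp [natWrites])]
        simp
      simp [FieldExpr.eval, FieldExpr.var, NatExpr.eval, NatExpr.var, e5, h7, hΦ, leafCurve, hx, hJ]
    · have e5 : s₂.nat 5 0 = j := by
        rw [hs₂.1 5 (by simp [natWrites])]
        simp
      have e4 : s₂.fld 4 i = s₁.fld 4 i := by
        rw [hs₂.2 4 (by simp [fldWrites])]
        simp
      simp [NatExpr.eval, NatExpr.var, e5, hi, e4]
  · have hP₁ : s₁.Params D n N K R m :=
      hP.congr (hs₁.1 0 (by simp [natWrites])) (hs₁.1 1 (by simp [natWrites]))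
    simp [NatExpr.eval, NatExpr.par, NatExpr.inp, hP₁.depth, hP₁.vars, hP₁.rank]
  · have e4 : s₂.fld 4 = s₁.fld 4 := hs₂.2 4 (by simp [fldWrites])
    simp [FieldExpr.eval, NatExpr.eval, NatExpr.var, e4, f4 j hj]
  · simp [NatExpr.eval, NatExpr.var, hi]
  · have e3 : s₂.nat 3 0 = 2 ^ h := by
      rw [hs₂.1 3 (by simp [natWrites]), hs₁.1 3 (by simp [natWrites]), hpw]
    simp only [NatExpr.eval, NatExpr.var, e3]
    exact (Nat.size_le_self _).trans (by omega)
  · have e3 : s₂.nat 3 0 = 2 ^ h := by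
      rw [hs₂.1 3 (by simp [natWrites]), hs₁.1 3 (by simp [natWrites]), hpw]
    simp [NatExpr.eval, NatExpr.var, e3, pow_succ, mul_comm]

theorem ok_levelsProg {ω : F} {k L : ℕ} (hP : s.Params D n N K R m)
    (hB : D * R * n ≤ B) (hmB : R * m ≤ B) (hmB' : m ≤ B) (hDB : 2 * D ≤ B) (hKB : K ≤ B)
    (hkB : k.size ≤ B) (hRm : R * R ≤ m) (hn0 : 0 < n) (hR0 : 0 < R) (hK0 : 0 < K)
    (hL : ∀ h, D ≤ 2 ^ h ↔ L ≤ h) (h3 : s.nat 3 0 = 1) (h4 : s.nat 4 0 = k / K)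
    (h2 : ∀ q < m, s.fld 2 q = ω ^ q)
    (h1 : HoldsCurves ω D n R m (fun h => e (k / K ^ h % K)) 0 s) :
    Ok e B levelsProg s (HoldsCurves ω D n R m (fun h => e (k / K ^ h % K)) L) := by
  have hLD : L ≤ D := (hL D).mp Nat.lt_two_pow_self.le
  have hR_le : R ≤ m := (Nat.le_mul_of_pos_left R hR0).trans hRm
  unfold levelsProg
  -- The height is not computed in advance: after `t` rounds it is `t`, or it has stopped at `L`.
  -- Since `L ≤ D`, the `D` rounds suffice.
  refine .loop (fun t s' => ∃ h ≤ L, (h = t ∨ h = L) ∧ s'.nat 3 0 = 2 ^ h ∧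
    s'.nat 4 0 = k / K ^ (h + 1) ∧ HoldsCurves ω D n R m (fun h => e (k / K ^ h % K)) h s')
    (l := D) (by simp [NatExpr.eval, NatExpr.inp, hP.depth]) (by omega)
    ⟨0, by omega, Or.inl rfl, by simpa using h3, by simpa using h4, h1⟩ ?_ ?_
  · rintro t ht s₁ hs₁ ⟨h, hhL, hh, f3, f4, f1⟩
    have hP₁ : (s₁.setNat 7 0 t).Params D n N K R m :=
      hP.congr ((funext fun i => by simp).trans (hs₁.1 0
          (by simp [natWrites, seedProg, tableProg, mergeProg])))
        ((funext fun i => by simp).trans (hs₁.1 1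
          (by simp [natWrites, seedProg, tableProg, mergeProg])))
    have f2 : ∀ q < m, (s₁.setNat 7 0 t).fld 2 q = ω ^ q := fun q hq => by
      rw [Memory.setNat_fld, hs₁.2 2 (by simp [fldWrites, seedProg, tableProg, mergeProg]), h2 q hq]
    have g3 : (s₁.setNat 7 0 t).nat 3 0 = 2 ^ h := by simp [f3]
    have g4 : (s₁.setNat 7 0 t).nat 4 0 = k / K ^ (h + 1) := by simp [f4]
    have g1 : HoldsCurves ω D n R m (fun h => e (k / K ^ h % K)) h (s₁.setNat 7 0 t) := f1
    refine .ifLe (fun hle => .skip ⟨h, hhL, ?_, g3, g4, g1⟩) (fun hlt => ?_)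
    · simp only [NatExpr.eval, NatExpr.inp, NatExpr.var, hP₁.depth, g3, hL] at hle
      exact Or.inr (by omega)
    · simp only [NatExpr.eval, NatExpr.inp, NatExpr.var, hP₁.depth, g3] at hlt
      have hhlt : h < L := by rw [hL] at hlt; omega
      refine .seq ((ok_seedProg hP₁ hKB hK0 g4
        ((Nat.size_le_size (Nat.div_le_self _ _)).trans hkB)).mono fun s₂ hs₂ ⟨i6, i4⟩ => ?_)
      have hP₂ : s₂.Params D n N K R m := hP₁.congr (hs₂.1 0 (by simp [natWrites, seedProg]))
        (hs₂.1 1 (by simp [natWrites, seedProg]))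
      refine .seq ((ok_tableProg hP₂ hmB hmB' hR_le (fun q hq => by
        rw [hs₂.2 2 (by simp [fldWrites, seedProg]), f2 q hq]) i6).mono fun s₃ hs₃ j3 => ?_)
      have hP₃ : s₃.Params D n N K R m := hP₂.congr (hs₃.1 0 (by simp [natWrites, tableProg]))
        (hs₃.1 1 (by simp [natWrites, tableProg]))
      have g1' : HoldsCurves ω D n R m (fun h => e (k / K ^ h % K)) h s₃ := fun i hi => by
        rw [hs₃.2 1 (by simp [fldWrites, tableProg]), hs₂.2 1 (by simp [fldWrites, seedProg])]
        exact g1 i hi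
      refine (ok_mergeProg hP₃ hB (by nlinarith) hDB hRm hn0 hR0 (h := h) (ω := ω)
        (α := fun h => e (k / K ^ h % K)) ?_ (by omega) j3 g1').mono
        fun s₄ hs₄ ⟨l3, l1⟩ => ⟨h + 1, hhlt, by omega, l3, ?_, l1⟩
      · rw [hs₃.1 3 (by simp [natWrites, tableProg]), hs₂.1 3 (by simp [natWrites, seedProg]), g3]
      · rw [hs₄.1 4 (by simp [natWrites, mergeProg]), hs₃.1 4 (by simp [natWrites, tableProg]), i4,
          Nat.div_div_eq_div_mul, ← pow_succ]
  · rintro s₁ - ⟨h, hhL, hh, -, -, f1⟩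
    obtain rfl : h = L := by omega
    exact f1

theorem ok_outputProg {ω : F} {α : ℕ → F} {L : ℕ} (hP : s.Params D n N K R m)
    (hB : n * ((D + 1) * (D + 1)) ≤ B) (hR0 : 0 < R) (h1 : HoldsCurves ω D n R m α L s) :
    Ok e B outputProg s fun s' => ∀ i < n * ((D + 1) * (D + 1)), s'.fld 0 i =
      if i % (D + 1) = i / (D + 1) % (D + 1) + 1 then
        generatedValues ω m R L α (i / (D + 1) % (D + 1)) (i / ((D + 1) * (D + 1))) else 0 := by
  unfold outputProg
  refine .fill (fun i => if i % (D + 1) = i / (D + 1) % (D + 1) + 1 then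
    generatedValues ω m R L α (i / (D + 1) % (D + 1)) (i / ((D + 1) * (D + 1))) else 0)
    (by simp [NatExpr.eval, NatExpr.inp, hP.depth, hP.vars]) hB (fun j hj s₁ hs₁ => ?_)
    (fun s' _ h => h)
  have hP₁ : s₁.Params D n N K R m :=
    hP.congr (hs₁.1 0 (by simp [natWrites])) (hs₁.1 1 (by simp [natWrites]))
  have f1 : s₁.fld 1 = s.fld 1 := hs₁.2 1 (by simp [fldWrites])
  refine .seq (.setField trivial (.ifLe (fun hle => .ifLe (fun hge => .setField trivial ?_)
    (fun hlt => .skip ?_)) (fun hlt => .skip ?_)))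
  · simp [NatExpr.eval, NatExpr.inp, NatExpr.var, hP₁.depth] at hle hge
    have heq : j % (D + 1) = j / (D + 1) % (D + 1) + 1 := by omega
    have hi : j / (D + 1) % (D + 1) < D := by
      have := Nat.mod_lt j (show 0 < D + 1 by omega)
      omega
    have hv : j / ((D + 1) * (D + 1)) < n := Nat.div_lt_of_lt_mul (by rwa [mul_comm])
    -- Point number `0` of the progression is `α L` itself, which is the point at which the top
    -- curve is evaluated.
    have hi0 : j / (D + 1) % (D + 1) * R + 0 < D * R := mul_add_lt hi hR0
    rw [add_zero] at hi0
    have key := h1 _ (mul_add_lt hi0 hv)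
    rw [mul_add_mod_self hv, ← Nat.div_div_eq_div_mul _ n R, mul_add_div_self hv,
      Nat.mul_div_cancel _ hR0, Nat.mul_mod_left, pow_zero, one_mul] at key
    refine ⟨?_, fun i hi' => ?_⟩
    · simp only [heq, if_true, generatedValues]
      rw [← key]
      simp [FieldExpr.eval, NatExpr.eval, NatExpr.inp, NatExpr.par, NatExpr.var, hP₁.depth,
        hP₁.rank, hP₁.vars, f1]
    · simp [NatExpr.eval, NatExpr.var, hi']
  · simp [NatExpr.eval, NatExpr.inp, NatExpr.var, hP₁.depth] at hle hlt
    refine ⟨?_, fun i hi' => ?_⟩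
    · rw [if_neg (by omega)]
      simp [FieldExpr.eval, NatExpr.eval, NatExpr.var]
    · simp [NatExpr.eval, NatExpr.var, hi']
  · simp [NatExpr.eval, NatExpr.inp, NatExpr.var, hP₁.depth] at hlt
    refine ⟨?_, fun i hi' => ?_⟩
    · rw [if_neg (by omega)]
      simp [FieldExpr.eval, NatExpr.eval, NatExpr.var]
    · simp [NatExpr.eval, NatExpr.var, hi']

theorem ok_setupProg {r k : ℕ} (hR : R = r * (D + 1)) (hm : m = n * (R * R))
    (hN : N = 2 * (D + 1) * m) (hK : K = 2 * (D + 1) * n * (m * R)) (hRB : R ≤ B) (hmB : m ≤ B)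
    (hNB : N ≤ B) (hKB : K ≤ B) (hB1 : 1 ≤ B) (hkB : k.size ≤ B) :
    Ok e B setupProg (input F D n r k) fun s => s.Params D n N K R m ∧
      s.nat 3 0 = 1 ∧ s.nat 4 0 = k := by
  have hle : ∀ {v : ℕ}, v ≤ B → v.size ≤ B := fun h => (Nat.size_le_self _).trans h
  unfold setupProg
  refine .seq (.setNat ?_ (.seq (.setNat ?_ (.seq (.setNat ?_ (.seq (.setNat ?_
    (.seq (.setNat ?_ (.setNat ?_ ⟨⟨?_, ?_, ?_, ?_, ?_, ?_⟩, ?_, ?_⟩)))))))))) <;>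
  simp [NatExpr.eval, NatExpr.inp, NatExpr.par, input, ← hR, ← hm, ← hN, ← hK, hle, hRB, hmB,
    hNB, hKB, hB1, hkB]

theorem ok_hittingProg {r k L : ℕ} (hD0 : 0 < D) (hn0 : 0 < n) (hr0 : 0 < r)
    (hR : R = r * (D + 1)) (hm : m = n * (R * R))
    (hN : N = 2 * (D + 1) * m) (hK : K = 2 * (D + 1) * n * (m * R)) (hNB : N * N ≤ B)
    (hkB : k.size ≤ B) (hL : ∀ h, D ≤ 2 ^ h ↔ L ≤ h) :
    Ok e B hittingProg (input F D n r k) fun s => ∀ i < n * ((D + 1) * (D + 1)), s.fld 0 i =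
        if i % (D + 1) = i / (D + 1) % (D + 1) + 1 then
          generatedValues (lastNoSmallOrder e N (N * N)) m R L (fun h => e (k / K ^ h % K))
            (i / (D + 1) % (D + 1)) (i / ((D + 1) * (D + 1))) else 0 := by
  have hR0 : 0 < R := hR ▸ by positivity
  have hRm : R * R ≤ m := hm ▸ Nat.le_mul_of_pos_left _ hn0
  have hR_le : R ≤ m := (Nat.le_mul_of_pos_left R hR0).trans hRm
  have hm0 : 0 < m := hR0.trans_le hR_le
  have hnm : n ≤ m := hm ▸ Nat.le_mul_of_pos_right _ (by positivity)
  have hDR : D + 1 ≤ R := hR ▸ Nat.le_mul_of_pos_left _ hr0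
  have hDm : 2 * (D + 1) ≤ N := hN ▸ Nat.le_mul_of_pos_right _ hm0
  have hmN : m ≤ N := hN ▸ Nat.le_mul_of_pos_left _ (by positivity)
  have hNN : N ≤ N * N := Nat.le_mul_of_pos_left _ (by omega)
  have hmB : m ≤ B := hmN.trans (hNN.trans hNB)
  have hnRm : n * R ≤ m := by
    rw [hm, ← mul_assoc]
    exact Nat.le_mul_of_pos_right _ hR0
  have hKB : K ≤ B := by
    refine le_trans ?_ hNB
    calc K = N * (n * R) := by rw [hK, hN]; ring
      _ ≤ N * N := Nat.mul_le_mul_left _ (hnRm.trans hmN)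
  have hK0 : 0 < K := hK ▸ by positivity
  have hRmB : R * m ≤ B := (Nat.mul_le_mul (hR_le.trans hmN) hmN).trans hNB
  have hDB : D * R * n ≤ B := by
    refine le_trans ?_ (hNN.trans hNB)
    calc D * R * n = D * (n * R) := by ring
      _ ≤ (2 * (D + 1)) * m := Nat.mul_le_mul (by omega) hnRm
      _ = N := hN.symm
  have houtB : n * ((D + 1) * (D + 1)) ≤ B := by
    refine le_trans ?_ hmB
    rw [hm]
    exact Nat.mul_le_mul_left _ (Nat.mul_le_mul hDR hDR)
  unfold hittingProg
  refine .seq ((ok_setupProg hR hm hN hK (hR_le.trans hmB) hmB (hNN.trans hNB) hKB (by omega)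
    hkB).mono fun s₁ hs₁ ⟨hP₁, f3, f4⟩ => ?_)
  refine .seq ((ok_orderProg hP₁ hNB (hNN.trans hNB) (by omega)
    (by rw [hs₁.2 5 (by simp [fldWrites, setupProg])]; rfl)).mono fun s₂ hs₂ hω => ?_)
  have hP₂ : s₂.Params D n N K R m := hP₁.congr (hs₂.1 0 (by simp [natWrites, orderProg]))
    (hs₂.1 1 (by simp [natWrites, orderProg]))
  set ω := lastNoSmallOrder e N (N * N)
  refine .seq ((ok_powersProg hP₂ hmB hω).mono fun s₃ hs₃ g2 => ?_)
  have hP₃ : s₃.Params D n N K R m := hP₂.congr (hs₃.1 0 (by simp [natWrites, powersProg]))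
    (hs₃.1 1 (by simp [natWrites, powersProg]))
  refine .seq ((ok_seedProg (k := k) hP₃ hKB hK0 (by
    rw [hs₃.1 4 (by simp [natWrites, powersProg]), hs₂.1 4 (by simp [natWrites, orderProg]), f4])
    hkB).mono fun s₄ hs₄ ⟨i6, i4⟩ => ?_)
  have hP₄ : s₄.Params D n N K R m := hP₃.congr (hs₄.1 0 (by simp [natWrites, seedProg]))
    (hs₄.1 1 (by simp [natWrites, seedProg]))
  have g2' : ∀ q < m, s₄.fld 2 q = ω ^ q := fun q hq => by
    rw [hs₄.2 2 (by simp [fldWrites, seedProg]), g2 q hq]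
  refine .seq ((ok_tableProg hP₄ hRmB hmB hR_le g2' i6).mono fun s₅ hs₅ j3 => ?_)
  have hP₅ : s₅.Params D n N K R m := hP₄.congr (hs₅.1 0 (by simp [natWrites, tableProg]))
    (hs₅.1 1 (by simp [natWrites, tableProg]))
  refine .seq ((ok_leafProg (ω := ω) (α := fun h => e (k / K ^ h % K)) hP₅ hDB hnm
    (by simpa using j3)).mono fun s₆ hs₆ h1 => ?_)
  have hP₆ : s₆.Params D n N K R m := hP₅.congr (hs₆.1 0 (by simp [natWrites, leafProg]))
    (hs₆.1 1 (by simp [natWrites, leafProg]))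
  refine .seq ((ok_levelsProg (k := k) (L := L) hP₆ hDB hRmB hmB (by omega) hKB hkB hRm hn0 hR0
    hK0 hL ?_ ?_ ?_ h1).mono fun s₇ hs₇ h1' => ?_)
  · rw [hs₆.1 3 (by simp [natWrites, leafProg]), hs₅.1 3 (by simp [natWrites, tableProg]),
      hs₄.1 3 (by simp [natWrites, seedProg]), hs₃.1 3 (by simp [natWrites, powersProg]),
      hs₂.1 3 (by simp [natWrites, orderProg]), f3]
  · rw [hs₆.1 4 (by simp [natWrites, leafProg]), hs₅.1 4 (by simp [natWrites, tableProg]), i4]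
  · intro q hq
    rw [hs₆.2 2 (by simp [fldWrites, leafProg]), hs₅.2 2 (by simp [fldWrites, tableProg]), g2' q hq]
  have hP₇ : s₇.Params D n N K R m := hP₆.congr
    (hs₇.1 0 (by simp [natWrites, levelsProg, seedProg, tableProg, mergeProg]))
    (hs₇.1 1 (by simp [natWrites, levelsProg, seedProg, tableProg, mergeProg]))
  exact (ok_outputProg hP₇ houtB hR0 h1').mono fun s₈ _ h => h

end Prog

/-! ### Parameters, digits and the conclusion. -/

theorem Prog.output_apply {F : Type*} [Field F] (P : Prog) (e : ℕ → F) (D n r k : ℕ) (v : Fin n)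
    (i j : Fin (D + 1)) : P.output e D n r k v i j =
      (P.exec e (input F D n r k)).1.fld 0 (((v : ℕ) * (D + 1) + i) * (D + 1) + j) := rfl

/-- A number with prescribed digits. -/
theorem Nat.exists_digits {K : ℕ} {d : ℕ → ℕ} (hd : ∀ i, d i < K) (l : ℕ) :
    ∃ k < K ^ l, ∀ h < l, k / K ^ h % K = d h := by
  induction l generalizing d with
  | zero => exact ⟨0, by simp, fun h hh => by omega⟩
  | succ l ih =>
    obtain ⟨k, hk, hdig⟩ := ih (d := fun i => d (i + 1)) fun i => hd (i + 1)
    refine ⟨k * K + d 0, ?_, fun h hh => ?_⟩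
    · rw [pow_succ]
      exact Prog.mul_add_lt hk (hd 0)
    · cases h with
      | zero => rw [pow_zero, Nat.div_one, Prog.mul_add_mod_self (hd 0)]
      | succ h =>
        rw [pow_succ', ← Nat.div_div_eq_div_mul, Prog.mul_add_div_self (hd 0)]
        exact hdig h (by omega)

theorem Prog.NoSmallOrder.injOn {F : Type*} [Field F] {ω : F} {N M : ℕ}
    (h : Prog.NoSmallOrder ω (N - 1)) (hM : M ≤ N) :
    Set.InjOn (fun i => ω ^ i) (Finset.range M) := by
  have key : ∀ i j, i < j → j < M → ω ^ i ≠ ω ^ j := fun i j hij hj heq => by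
    refine h.2 (j - i) (by omega) (by omega) (mul_left_cancel₀ (pow_ne_zero i h.1) ?_)
    rw [← pow_add, mul_one, heq]
    congr 1
    omega
  intro i hi j hj hij
  simp only [Finset.coe_range, Set.mem_Iio] at hi hj
  rcases lt_trichotomy i j with hlt | heq | hlt
  · exact absurd hij (key i j hlt hj)
  · exact heq
  · exact absurd hij.symm (key j i hlt hi)

/-- The equations `x ^ l = 1` with `1 ≤ l ≤ N - 1` have at most `(N - 1) ^ 2` solutions in total;
together with `0` this is fewer than `N * N`. -/
theorem Prog.exists_noSmallOrder {F : Type*} [Field F] {e : ℕ → F} {N : ℕ} (hN : 2 ≤ N)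
    (he : Set.InjOn e (Finset.range (N * N))) :
    ∃ c < N * N, Prog.NoSmallOrder (e c) (N - 1) := by
  classical
  obtain ⟨c, hc, hgood⟩ := exists_lt_notMem he
    (s := insert 0 ((Finset.Icc 1 (N - 1)).biUnion fun l =>
      (Polynomial.nthRoots l (1 : F)).toFinset)) (by
    refine lt_of_le_of_lt (Finset.card_insert_le _ _) ?_
    refine lt_of_le_of_lt (Nat.succ_le_succ (Finset.card_biUnion_le_card_mul _ _ (N - 1)
      fun l hl => ?_)) ?_
    · exact (Multiset.toFinset_card_le _).trans ((Polynomial.card_nthRoots l 1).trans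
        (Finset.mem_Icc.mp hl).2)
    · obtain ⟨N, rfl⟩ := Nat.exists_eq_add_of_le hN
      simp only [Nat.card_Icc]
      have : 2 + N - 1 = N + 1 := by omega
      rw [this, Nat.add_sub_cancel]
      nlinarith)
  refine ⟨c, hc, fun h0 => hgood (by simp [h0]), fun l h1 h2 h3 => hgood ?_⟩
  refine Finset.mem_insert_of_mem (Finset.mem_biUnion.mpr ⟨l, Finset.mem_Icc.mpr ⟨h1, h2⟩, ?_⟩)
  rw [Multiset.mem_toFinset, Polynomial.mem_nthRoots (by omega)]
  exact h3

theorem generatedValues_congr {F : Type*} [Field F] (ω : F) (m R : ℕ) {L : ℕ} {α α' : ℕ → F}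
    (h : ∀ l ≤ L, α l = α' l) :
    generatedValues ω m R L α = generatedValues ω m R L α' := by
  funext j i
  rw [generatedValues, generatedValues, h L le_rfl]
  exact leafCurve_congr ω m R (fun l hl => h l hl.le) j _ i

/-- A bound on the bit lengths, the numbers of rounds and the listed elements that occur in the
execution of `Prog.hittingProg`. -/
def resourceBound {S : Type*} [CommSemiring S] (D n r : S) : S :=
  (2 * (D + 1) ^ 3 * n * r ^ 2) ^ 2 + (D + 1) * (2 * (D + 1) ^ 4 * n ^ 2 * r ^ 3) + D + n + r

/-- The outputs of `Prog.hittingProg` form a hitting set. -/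
theorem exists_isHittingSet_hittingProg {F : Type*} [Field F] {e : ℕ → F} (he : IsFieldListing e)
    {D n r : ℕ} (hD : 1 ≤ D) (hn : 1 ≤ n) (hr : 1 ≤ r)
    (hF : (((2 * (D + 1) ^ 5 * n * r ^ 4) ^ 2 : ℕ) : ℕ∞) ≤ ENat.card F) :
    ∃ M : ℕ,
      IsHittingSet (NCABPClass F n r D) {x | ∃ k < M, Prog.hittingProg.output e D n r k = x} ∧
      (∀ k < M, (Prog.input F D n r k).NatBounded (resourceBound D n r) ∧
        Prog.hittingProg.Safe e (resourceBound D n r) (Prog.input F D n r k)) ∧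
      M ≤ (2 * (D + 1) ^ 4 * n ^ 2 * r ^ 3) ^ (Nat.clog 2 D + 1) := by
  -- `R` bounds the dimension of the transitions; `m` dominates both `R * R` and `n`, the numbers of
  -- nodes of the curves; `N` exceeds the degree `2 ^ L * m`; `K` exceeds the number of bad seeds at
  -- each height. The equations keep these quantities opaque to arithmetic tactics.
  obtain ⟨R, hR⟩ : ∃ R, R = r * (D + 1) := ⟨_, rfl⟩
  obtain ⟨m, hm⟩ : ∃ m, m = n * (R * R) := ⟨_, rfl⟩
  obtain ⟨N, hN⟩ : ∃ N, N = 2 * (D + 1) * m := ⟨_, rfl⟩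
  obtain ⟨K, hK⟩ : ∃ K, K = 2 * (D + 1) * n * (m * R) := ⟨_, rfl⟩
  obtain ⟨L, hL⟩ : ∃ L, L = Nat.clog 2 D := ⟨_, rfl⟩
  have hclog : ∀ h, D ≤ 2 ^ h ↔ L ≤ h := fun h => by
    rw [hL, Nat.clog_le_iff_le_pow (by norm_num)]
  have hR0 : 0 < R := hR ▸ by positivity
  have hRm : R * R ≤ m := hm ▸ Nat.le_mul_of_pos_left _ hn
  have hm0 : 0 < m := (Nat.mul_pos hR0 hR0).trans_le hRm
  have hnm : n ≤ m := hm ▸ Nat.le_mul_of_pos_right _ (by positivity)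
  have hK' : K = 2 * (D + 1) ^ 4 * n ^ 2 * r ^ 3 := by rw [hK, hm, hR]; ring
  have hN' : N = 2 * (D + 1) ^ 3 * n * r ^ 2 := by rw [hN, hm, hR]; ring
  -- Minimality of `L` gives `2 ^ (L - 1) < D`; the case `L = 0` is separate because the exponent
  -- subtraction truncates.
  have hpowL : 2 ^ L < 2 * (D + 1) := by
    rcases Nat.eq_zero_or_pos L with h0 | hpos
    · rw [h0]; omega
    · have h1 : ¬ D ≤ 2 ^ (L - 1) := by rw [hclog]; omega
      have h2 : 2 ^ L = 2 * 2 ^ (L - 1) := by rw [← pow_succ']; congr 1; omega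
      omega
  have hLD : L ≤ D := (hclog D).mp Nat.lt_two_pow_self.le
  have hδN : 2 ^ L * m + 1 ≤ N := hN ▸ Nat.mul_lt_mul_of_pos_right hpowL hm0
  have hKbig : 2 ^ L * (R * m) < K := by
    calc 2 ^ L * (R * m) < 2 * (D + 1) * (R * m) :=
          Nat.mul_lt_mul_of_pos_right hpowL (by positivity)
      _ ≤ n * (2 * (D + 1) * (R * m)) := Nat.le_mul_of_pos_left _ hn
      _ = K := by rw [hK]; ring
  have hN2 : 2 ≤ N := by
    have : 1 * 1 ≤ 2 ^ L * m := Nat.mul_le_mul Nat.one_le_two_pow hm0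
    omega
  obtain ⟨Q, hQ⟩ : ∃ Q, Q = (2 * (D + 1) ^ 5 * n * r ^ 4) ^ 2 := ⟨_, rfl⟩
  -- The field is larger than the dominant requirement `R * N * N` by the factor `R ^ 3`, which
  -- absorbs the additive constants.
  have hQ' : Q = R * N * N * (r * (D + 1)) ^ 3 := by rw [hQ, hN', hR]; ring
  have hRNQ : 2 * (R * N * N) ≤ Q := by
    have h2 : 2 ≤ (r * (D + 1)) ^ 3 :=
      calc 2 ≤ r * (D + 1) := (show 2 ≤ D + 1 by omega).trans (Nat.le_mul_of_pos_left _ hr)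
        _ ≤ _ := Nat.le_self_pow (by norm_num) _
    rw [hQ', mul_comm 2]
    exact Nat.mul_le_mul_left _ h2
  have hNNR : N * N ≤ R * N * N := by
    rw [mul_assoc]
    exact Nat.le_mul_of_pos_left _ hR0
  have hNN2 : 2 * 2 ≤ N * N := Nat.mul_le_mul hN2 hN2
  have hKQ : K ≤ Q := by
    have hmN : m ≤ N := (Nat.le_mul_of_pos_left m (Nat.two_pow_pos L)).trans (by omega)
    have h1 : K = N * (n * R) := by rw [hK, hN]; ring
    have h2 : N * (n * R) ≤ N * (N * R) :=
      Nat.mul_le_mul_left _ (Nat.mul_le_mul_right _ (hnm.trans hmN))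
    have h3 : N * (N * R) = R * N * N := by ring
    omega
  rw [← hQ] at hF
  have heinj : ∀ {M : ℕ}, M ≤ Q → Set.InjOn e (Finset.range M) := fun {M} hM i hi j hj hij => by
    simp only [Finset.coe_range, Set.mem_Iio] at hi hj
    refine he i j (lt_of_lt_of_le ?_ hF) (lt_of_lt_of_le ?_ hF) hij
    · exact_mod_cast hi.trans_le hM
    · exact_mod_cast hj.trans_le hM
  have hlarge : ∀ s : Finset F,
      s.card ≤ (2 ^ L * m + 1) * (R * (2 ^ L * m)) + 1 → ∃ x, x ∉ s := fun s hs => by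
    obtain ⟨i, -, hi⟩ := exists_lt_notMem (heinj le_rfl) (s := s) (lt_of_le_of_lt hs (by
      have h1 : (2 ^ L * m + 1) * (R * (2 ^ L * m)) ≤ N * (R * N) :=
        Nat.mul_le_mul hδN (Nat.mul_le_mul_left _ (by omega))
      have h2 : N * (R * N) = R * N * N := by ring
      omega))
    exact ⟨e i, hi⟩
  have hω := Prog.noSmallOrder_last (Prog.exists_noSmallOrder hN2 (heinj (by omega)))
  have hB : resourceBound D n r = N ^ 2 + (D + 1) * K + D + n + r := by
    simp only [resourceBound, hN', hK']
  -- Although `k` may be quasipolynomially large, its bit length is at most `K * (L + 1)`; this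
  -- accounts for the term `(D + 1) * K` in `resourceBound`.
  have hkB : ∀ k < K ^ (L + 1), k.size ≤ resourceBound D n r := fun k hk => by
    refine Nat.size_le.mpr (hk.trans_le ?_)
    calc K ^ (L + 1) ≤ (2 ^ K) ^ (L + 1) := Nat.pow_le_pow_left Nat.lt_two_pow_self.le _
      _ = 2 ^ (K * (L + 1)) := by rw [pow_mul]
      _ ≤ _ := Nat.pow_le_pow_right (by norm_num) (by
        have : K * (L + 1) ≤ (D + 1) * K := by
          rw [mul_comm]; exact Nat.mul_le_mul_right _ (by omega)
        omega)
  have hok := fun k (hk : k < K ^ (L + 1)) =>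
    Prog.ok_hittingProg (e := e) (B := resourceBound D n r) (k := k) (L := L) hD hn hr hR hm hN hK
      (by rw [hB, sq]; omega) (hkB k hk) hclog
  have hout : ∀ k < K ^ (L + 1), Prog.hittingProg.output e D n r k =
      shiftTuple n D (generatedValues (Prog.lastNoSmallOrder e N (N * N)) m R L
        fun h => e (k / K ^ h % K)) := fun k hk => by
    funext v
    ext i j
    have h1 := Prog.mul_add_lt (Prog.mul_add_lt v.2 i.2) j.2
    have h2 := (hok k hk).2 _ (by rwa [← mul_assoc])
    rw [← Nat.div_div_eq_div_mul, Prog.mul_add_mod_self j.2, Prog.mul_add_div_self j.2,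
      Prog.mul_add_mod_self i.2, Prog.mul_add_div_self i.2] at h2
    rw [Prog.output_apply, h2, shiftTuple, Matrix.of_apply]
  refine ⟨K ^ (L + 1), ?_, fun k hk => ⟨fun a i => ?_, (hok k hk).1⟩, by rw [hK', hL]⟩
  · intro f hf
    refine ⟨fun h0 x _ => by rw [h0, map_zero], fun hall => ?_⟩
    by_contra hf0
    obtain ⟨d, hd, hne⟩ := exists_seeds_lift_ne_zero hn hr ((hclog L).mpr le_rfl) hω.1
      (hω.injOn hδN) hR.ge hRm hnm hlarge (heinj hKQ) hKbig hf hf0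
    -- The index is built from the numbers of the good seeds. Only the digits at positions `0, …, L`
    -- influence the generated tuple.
    obtain ⟨k, hk, hdig⟩ := Nat.exists_digits hd (L + 1)
    refine hne ?_
    have := hall _ ⟨k, hk, rfl⟩
    rwa [hout k hk, generatedValues_congr (α' := fun i => e (d i)) _ m R
      fun l hl => by rw [hdig l (by omega)]] at this
  · simp only [Prog.input]
    split_ifs
    · have hD' := Nat.size_le_self D
      have hn' := Nat.size_le_self n
      have hr' := Nat.size_le_self r
      have hk' := hkB k hk
      rcases i with _ | _ | _ | _ | i <;> simp <;> omega
    · simp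

theorem mainTheorem5 :
    ∃ (P : Prog) (T : MvPolynomial (Fin 3) ℕ),
      ∀ (F : Type*) [Field F] (e : ℕ → F), IsFieldListing e →
      ∀ D n r : ℕ, 1 ≤ D → 1 ≤ n → 1 ≤ r →
        (((2 * (D + 1) ^ 5 * n * r ^ 4) ^ 2 : ℕ) : ℕ∞) ≤ ENat.card F →
        ∃ (H : Set (Fin n → Matrix (Fin (D + 1)) (Fin (D + 1)) F)) (M : ℕ),
          IsHittingSet (NCABPClass F n r D) H ∧
          IsExplicitVia P e (MvPolynomial.eval ![D, n, r] T) D n r M H ∧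
          M ≤ (2 * (D + 1) ^ 4 * n ^ 2 * r ^ 3) ^ (Nat.clog 2 D + 1) := by
  -- `resourceBound` is stated over any commutative semiring so that it can be instantiated both
  -- with variables, to give the time polynomial, and with numbers.
  refine ⟨Prog.hittingProg, MvPolynomial.C Prog.hittingProg.weight *
    (resourceBound (MvPolynomial.X 0) (MvPolynomial.X 1) (MvPolynomial.X 2) + 1) ^
      Prog.hittingProg.degree, ?_⟩
  intro F _ e he D n r hD hn hr hF
  have hT : MvPolynomial.eval ![D, n, r] (MvPolynomial.C Prog.hittingProg.weight *
      (resourceBound (MvPolynomial.X 0) (MvPolynomial.X 1) (MvPolynomial.X 2) + 1) ^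
        Prog.hittingProg.degree) =
      Prog.hittingProg.weight * (resourceBound D n r + 1) ^ Prog.hittingProg.degree := by
    rw [map_mul, map_pow, MvPolynomial.eval_C]
    simp [resourceBound]
  rw [hT]
  obtain ⟨M, hM, hsafe, hle⟩ := exists_isHittingSet_hittingProg he hD hn hr hF
  exact ⟨_, M, hM, ⟨rfl, fun k hk =>
    (Prog.natBounded_and_time_le _ (hsafe k hk).1 (hsafe k hk).2).2⟩, hle⟩
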